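/- Let $\mathcal H$ be a separable complex Hilbert space and, for $1\le p<\infty$, let $\mathcal S^p$ denote the Schatten class of bounded operators $T$ on $\mathcal H$ with $\operatorname{Tr}(|T|^p)<\infty$. A locally compact spectral triple $(\mathcal A,\mathcal H,D)$ of summability $s\in\mathbb N$, $s\ge 1$, consists of a self-adjoint (possibly unbounded) operator $D$ in $\mathcal H$ and a (not necessarily unital) $*$-algebra $\mathcal A\subseteq\mathcal B(\mathcal H)$ such that for every $a\in\mathcal A$: $a(\operatorname{dom} D)\subseteq\operatorname{dom} D$, the commutator $[D,a]$ extends to a bounded operator (also denoted $[D,a]$), and $a(D-iI)^{-s}\in\mathcal S^1$. Let $\delta_D(T)$ be the bounded extension of $[|D|,T]$, defined on those $T\in\mathcal B(\mathcal H)$ with $T(\operatorname{dom}|D|)\subseteq\operatorname{dom}|D|$ for which $[|D|,T]$ extends to a bounded operator. The triple is regular if $a,[D,a]\in\bigcap_{k\ge1}\operatorname{dom}(\delta_D^k)$ for all $a\in\mathcal A$. Theorem. Let $(\mathcal A,\mathcal H,D)$ be a regular locally compact spectral triple of summability $s$. Then $V(D-iI)^{-1}\in\mathcal S^s$ for every Connes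 differential one-form $V=\sum_{j=1}^n a_j[D,b_j]$ with $n\in\mathbb N$ and $a_j,b_j\in\mathcal A$. -/

import Mathlib

open scoped InnerProductSpace

universe u

namespace SpectralTriple

variable {H : Type u} [NormedAddCommGroup H] [InnerProductSpace ℂ H] [CompleteSpace H]

/-! ### Schatten classes -/

/-- The Schatten class `S^p` for `0 < p < ∞`: the bounded operators `T` with `Tr (|T|^p) < ∞`,
where `|T| = (T* T)^{1/2}`, the power is taken by the continuous functional calculus, and the trace
of a positive operator `A` is `∑ ⟨b i, A (b i)⟩` over an orthonormal basis `b` (finiteness does not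
depend on `b`).  Such operators are automatically compact. -/
def schattenClass (H : Type u) [NormedAddCommGroup H] [InnerProductSpace ℂ H] [CompleteSpace H]
    (p : ℝ) : Set (H →L[ℂ] H) :=
  {T | ∀ (ι : Type u) (b : HilbertBasis ι ℂ H),
    Summable fun i => RCLike.re ⟪b i, (CFC.abs T ^ p : H →L[ℂ] H) (b i)⟫_ℂ}

/-! ### Resolvents of unbounded operators -/

/-- The bounded operator `B` is the inverse of `D - z : dom D → H`. -/
def IsResolvent (D : H →ₗ.[ℂ] H) (z : ℂ) (B : H →L[ℂ] H) : Prop :=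
  (∀ y : H, ∃ h : B y ∈ D.domain, D ⟨B y, h⟩ - z • B y = y) ∧
    ∀ x : D.domain, B (D x - z • (x : H)) = x

theorem symm_of_isSelfAdjoint {D : H →ₗ.[ℂ] H} (hD : IsSelfAdjoint D) (x y : D.domain) :
    ⟪D x, (y : H)⟫_ℂ = ⟪(x : H), D y⟫_ℂ := by
  have h := LinearPMap.adjoint_isFormalAdjoint hD.dense_domain
  rw [LinearPMap.isSelfAdjoint_def.mp hD] at h
  exact h x y

theorem mem_domain_of_inner {D : H →ₗ.[ℂ] H} (hD : IsSelfAdjoint D) {y w : H}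
    (h : ∀ x : D.domain, ⟪w, (x : H)⟫_ℂ = ⟪y, D x⟫_ℂ) :
    ∃ hy : y ∈ D.domain, D ⟨y, hy⟩ = w := by
  have h1 : y ∈ D.adjoint.domain := LinearPMap.mem_adjoint_domain_of_exists y ⟨w, h⟩
  have h2 : D.adjoint ⟨y, h1⟩ = w := LinearPMap.adjoint_apply_eq hD.dense_domain ⟨y, h1⟩ h
  have h3 : (y, w) ∈ D.adjoint.graph := by
    rw [LinearPMap.mem_graph_iff]; exact ⟨⟨y, h1⟩, rfl, h2⟩
  rw [LinearPMap.isSelfAdjoint_def.mp hD, LinearPMap.mem_graph_iff] at h3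
  obtain ⟨v, hv, hw⟩ := h3
  subst hv
  exact ⟨v.2, hw⟩

theorem norm_sub_smul_ge {D : H →ₗ.[ℂ] H} (hD : IsSelfAdjoint D) (z : ℂ) (x : D.domain) :
    |z.im| * ‖(x : H)‖ ≤ ‖D x - z • (x : H)‖ := by
  have h0 : (⟪(x : H), D x⟫_ℂ).im = 0 := by
    have h := inner_conj_symm (𝕜 := ℂ) (x : H) (D x)
    rw [symm_of_isSelfAdjoint hD x x] at h
    exact Complex.conj_eq_iff_im.mp h
  have h1 : (⟪(x : H), D x - z • (x : H)⟫_ℂ).im = - (z.im * ‖(x : H)‖ ^ 2) := by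
    rw [inner_sub_right, inner_smul_right, inner_self_eq_norm_sq_to_K, Complex.sub_im, h0,
      Complex.mul_im]
    have h5 : ((‖(x : H)‖ : ℂ) ^ 2) = ((‖(x : H)‖ ^ 2 : ℝ) : ℂ) := by push_cast; rfl
    simp only [Complex.coe_algebraMap, h5, Complex.ofReal_re, Complex.ofReal_im]
    ring
  have h2 : |z.im| * ‖(x : H)‖ ^ 2 ≤ ‖(x : H)‖ * ‖D x - z • (x : H)‖ := by
    have h3 := Complex.abs_im_le_norm ⟪(x : H), D x - z • (x : H)⟫_ℂ
    rw [h1, abs_neg, abs_mul, abs_of_nonneg (sq_nonneg ‖(x : H)‖)] at h3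
    exact h3.trans (norm_inner_le_norm _ _)
  rcases (norm_nonneg (x : H)).eq_or_lt with h | h
  · rw [← h]; simp
  · refine le_of_mul_le_mul_left ?_ h
    nlinarith

/-- A self-adjoint operator has a bounded resolvent at every non-real point. -/
theorem exists_isResolvent {D : H →ₗ.[ℂ] H} (hD : IsSelfAdjoint D) {z : ℂ} (hz : z.im ≠ 0) :
    ∃ B, IsResolvent D z B := by
  have hz' : 0 < |z.im| := abs_pos.mpr hz
  let T : D.domain →ₗ[ℂ] H := D.toFun - z • D.domain.subtype
  have hT : ∀ x, T x = D x - z • (x : H) := fun x => rfl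
  have hinj : Function.Injective T := by
    refine (injective_iff_map_eq_zero T).mpr fun x hx => ?_
    have h := norm_sub_smul_ge hD z x
    rw [← hT, hx, norm_zero] at h
    have : ‖(x : H)‖ ≤ 0 := by
      by_contra hc
      push Not at hc
      nlinarith [mul_pos hz' hc]
    exact Subtype.ext (norm_le_zero_iff.mp this)
  have hclosed : IsClosed (T.range : Set H) := by
    rw [← isSeqClosed_iff_isClosed]
    intro s y hs hsy
    choose x hx using hs
    have hc : CauchySeq fun n => (x n : H) := by
      rw [Metric.cauchySeq_iff']
      intro ε hε
      obtain ⟨N, hN⟩ := Metric.cauchySeq_iff'.mp hsy.cauchySeq (|z.im| * ε) (by positivity)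
      refine ⟨N, fun n hn => ?_⟩
      have h1 := hN n hn
      have h2 := norm_sub_smul_ge hD z (x n - x N)
      rw [← hT, map_sub, hx, hx] at h2
      rw [dist_eq_norm] at h1 ⊢
      exact lt_of_mul_lt_mul_left (h2.trans_lt h1) hz'.le
    obtain ⟨x₀, hx₀⟩ := cauchySeq_tendsto_of_complete hc
    have h3 : Filter.Tendsto (fun n => D (x n)) Filter.atTop (nhds (y + z • x₀)) := by
      have := hsy.add (hx₀.const_smul z)
      refine this.congr fun n => ?_
      rw [← hx n, hT]; simp
    have h4 : (x₀, y + z • x₀) ∈ D.graph := by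
      refine hD.isClosed.mem_of_tendsto (hx₀.prodMk_nhds h3) (Filter.Eventually.of_forall fun n => ?_)
      exact D.mem_graph (x n)
    rw [LinearPMap.mem_graph_iff] at h4
    obtain ⟨v, hv, hw⟩ := h4
    refine ⟨v, ?_⟩
    simp only at hv hw
    rw [hT, hw, hv]; simp
  have hrange : T.range = ⊤ := by
    have : CompleteSpace T.range := hclosed.completeSpace_coe
    rw [← Submodule.orthogonal_eq_bot_iff, eq_bot_iff]
    intro y hy
    rw [Submodule.mem_orthogonal'] at hy
    have h1 : ∀ x : D.domain, ⟪(starRingEnd ℂ z) • y, (x : H)⟫_ℂ = ⟪y, D x⟫_ℂ := by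
      intro x
      have h := hy (T x) ⟨x, rfl⟩
      rw [hT, inner_sub_right, inner_smul_right, sub_eq_zero] at h
      rw [inner_smul_left, h]; simp
    obtain ⟨hyD, h2⟩ := mem_domain_of_inner hD h1
    have h3 := norm_sub_smul_ge hD (starRingEnd ℂ z) ⟨y, hyD⟩
    rw [h2, sub_self, norm_zero, Complex.conj_im, abs_neg] at h3
    have : ‖y‖ ≤ 0 := by
      by_contra hc
      push Not at hc
      exact absurd (mul_pos hz' hc) (not_lt.mpr h3)
    exact (Submodule.mem_bot ℂ).mpr (norm_le_zero_iff.mp this)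
  let e : D.domain ≃ₗ[ℂ] H := LinearEquiv.ofBijective T ⟨hinj, LinearMap.range_eq_top.mp hrange⟩
  have he : ∀ y, D (e.symm y) - z • (e.symm y : H) = y := fun y => by
    rw [← hT]; exact e.apply_symm_apply y
  refine ⟨(D.domain.subtype ∘ₗ e.symm.toLinearMap).mkContinuous |z.im|⁻¹ fun y => ?_, ?_, ?_⟩
  · have h := norm_sub_smul_ge hD z (e.symm y)
    rw [he] at h
    rw [inv_mul_eq_div, le_div_iff₀ hz', mul_comm]
    exact h
  · exact fun y => ⟨(e.symm y).2, he y⟩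
  · exact fun x => congrArg Subtype.val (e.symm_apply_apply x)

open Classical in
/-- The resolvent `(D - z)⁻¹` as a bounded operator on `H` (and `0` if there is none). -/
noncomputable def resolvent (D : H →ₗ.[ℂ] H) (z : ℂ) : H →L[ℂ] H :=
  if h : ∃ B, IsResolvent D z B then h.choose else 0

theorem isResolvent_resolvent {D : H →ₗ.[ℂ] H} (hD : IsSelfAdjoint D) {z : ℂ} (hz : z.im ≠ 0) :
    IsResolvent D z (resolvent D z) := by
  have h := exists_isResolvent hD hz
  rw [resolvent, dif_pos h]
  exact h.choose_spec

/-! ### The absolute value of a self-adjoint operator -/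

/-- For self-adjoint `D`, the bounded operator `(1 + D²)⁻¹ = (D + i)⁻¹ (D - i)⁻¹`, where
`(D + i)⁻¹` is the adjoint of `(D - i)⁻¹`. -/
noncomputable def invOneAddSq (D : H →ₗ.[ℂ] H) : H →L[ℂ] H :=
  star (resolvent D Complex.I) * resolvent D Complex.I

/-- The absolute value `|D|` of a self-adjoint operator `D`, by functional calculus: with
`R = (1 + D²)⁻¹`, it is `|D| = (1 - R)^{1/2} (R^{1/2})⁻¹`, with domain the range of
`R^{1/2} = (1 + D²)^{-1/2}`.  It is the positive self-adjoint square root of `D²`: see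
`absOp_isSelfAdjoint`, `absOp_nonneg` and `absOp_sq`. -/
noncomputable def absOp (D : H →ₗ.[ℂ] H) : H →ₗ.[ℂ] H :=
  (CFC.sqrt (1 - invOneAddSq D)).toLinearMap.compPMap
    ((CFC.sqrt (invOneAddSq D)).toLinearMap.toPMap ⊤).inverse

theorem isResolvent_star {D : H →ₗ.[ℂ] H} (hD : IsSelfAdjoint D) :
    IsResolvent D (-Complex.I) (star (resolvent D Complex.I)) := by
  obtain ⟨B, hB⟩ := exists_isResolvent hD (z := -Complex.I) (by simp)
  have hA := isResolvent_resolvent hD (z := Complex.I) (by simp)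
  suffices h : star (resolvent D Complex.I) = B by rw [h]; exact hB
  rw [ContinuousLinearMap.star_eq_adjoint, eq_comm, ContinuousLinearMap.eq_adjoint_iff]
  intro x y
  obtain ⟨h1, h2⟩ := hB.1 x
  obtain ⟨h3, h4⟩ := hA.1 y
  have h5 := symm_of_isSelfAdjoint hD ⟨B x, h1⟩ ⟨_, h3⟩
  simp only at h5
  conv_lhs => rw [← h4]
  conv_rhs => rw [← h2]
  rw [inner_sub_right, inner_sub_left, h5, inner_smul_left, inner_smul_right]
  simp

theorem invOneAddSq_nonneg (D : H →ₗ.[ℂ] H) : 0 ≤ invOneAddSq D := star_mul_self_nonneg _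

theorem invOneAddSq_le_one {D : H →ₗ.[ℂ] H} (hD : IsSelfAdjoint D) :
    0 ≤ 1 - invOneAddSq D := by
  have hA := isResolvent_resolvent hD (z := Complex.I) (by simp)
  have hn : ‖resolvent D Complex.I‖ ≤ 1 := by
    refine ContinuousLinearMap.opNorm_le_bound _ zero_le_one fun y => ?_
    obtain ⟨h1, h2⟩ := hA.1 y
    have h := norm_sub_smul_ge hD Complex.I ⟨_, h1⟩
    rw [h2] at h
    simpa using h
  rw [sub_nonneg, invOneAddSq]
  refine CStarAlgebra.norm_le_one_iff_of_nonneg _ (star_mul_self_nonneg _) |>.mp ?_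
  rw [CStarRing.norm_star_mul_self]
  nlinarith [norm_nonneg (resolvent D Complex.I)]

theorem sqrt_facts {D : H →ₗ.[ℂ] H} (hD : IsSelfAdjoint D) :
    (∀ y, CFC.sqrt (invOneAddSq D) (CFC.sqrt (invOneAddSq D) y) = invOneAddSq D y) ∧
    (∀ y, CFC.sqrt (1 - invOneAddSq D) (CFC.sqrt (1 - invOneAddSq D) y) = y - invOneAddSq D y) ∧
    (∀ y, CFC.sqrt (1 - invOneAddSq D) (CFC.sqrt (invOneAddSq D) y) =
      CFC.sqrt (invOneAddSq D) (CFC.sqrt (1 - invOneAddSq D) y)) ∧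
    Commute (CFC.sqrt (1 - invOneAddSq D)) (CFC.sqrt (invOneAddSq D)) := by
  have h1 := CFC.sqrt_mul_sqrt_self _ (invOneAddSq_nonneg D)
  have h2 := CFC.sqrt_mul_sqrt_self _ (invOneAddSq_le_one hD)
  have h3 : Commute (1 - invOneAddSq D) (invOneAddSq D) :=
    (Commute.one_left _).sub_left (Commute.refl _)
  have h4 : Commute (CFC.sqrt (1 - invOneAddSq D)) (CFC.sqrt (invOneAddSq D)) :=
    ((h3.cfcₙ_nnreal NNReal.sqrt).symm.cfcₙ_nnreal NNReal.sqrt).symm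
  exact ⟨fun y => congrArg (fun T : H →L[ℂ] H => T y) h1,
    fun y => congrArg (fun T : H →L[ℂ] H => T y) h2,
    fun y => congrArg (fun T : H →L[ℂ] H => T y) h4.eq, h4⟩

theorem sqrt_inner (T : H →L[ℂ] H) (x y : H) : ⟪CFC.sqrt T x, y⟫_ℂ = ⟪x, CFC.sqrt T y⟫_ℂ := by
  have h := ((ContinuousLinearMap.nonneg_iff_isPositive _).mp (CFC.sqrt_nonneg T)).isSymmetric
  exact h x y

theorem sqrt_injective {D : H →ₗ.[ℂ] H} (hD : IsSelfAdjoint D) {x : H}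
    (hx : CFC.sqrt (invOneAddSq D) x = 0) : x = 0 := by
  have h1 := (sqrt_facts hD).1 x
  rw [hx, map_zero] at h1
  have hR : ∀ (z : ℂ) (B : H →L[ℂ] H), IsResolvent D z B → ∀ y, B y = 0 → y = 0 := by
    intro z B hB y hy
    obtain ⟨h2, h3⟩ := hB.1 y
    have h4 : (⟨B y, h2⟩ : D.domain) = 0 := Subtype.ext hy
    rw [h4, hy] at h3
    simpa using h3.symm
  exact hR _ _ (isResolvent_resolvent hD (by simp)) _ (hR _ _ (isResolvent_star hD) _ h1.symm)

/-- The graph of `|D|`. -/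
theorem mem_absOp_graph {D : H →ₗ.[ℂ] H} (hD : IsSelfAdjoint D) {x w : H} :
    (x, w) ∈ (absOp D).graph ↔
      ∃ y, CFC.sqrt (invOneAddSq D) y = x ∧ CFC.sqrt (1 - invOneAddSq D) y = w := by
  set f := (CFC.sqrt (invOneAddSq D)).toLinearMap.toPMap ⊤ with hf
  have hker : f.toFun.ker = ⊥ := by
    refine LinearMap.ker_eq_bot'.mpr fun y hy => ?_
    exact Subtype.ext (sqrt_injective hD hy)
  have hg : ∀ a b : H, (a, b) ∈ f.inverse.graph ↔ CFC.sqrt (invOneAddSq D) b = a := by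
    intro a b
    rw [LinearPMap.inverse_graph hker, Submodule.mem_map]
    constructor
    · rintro ⟨⟨p, q⟩, hpq, h⟩
      rw [LinearPMap.mem_graph_iff] at hpq
      obtain ⟨v, hv, hw⟩ := hpq
      simp only at hv hw
      obtain ⟨rfl, rfl⟩ := Prod.mk.inj h
      subst hv
      exact hw
    · rintro rfl
      exact ⟨(b, _), f.mem_graph ⟨b, Submodule.mem_top⟩, rfl⟩
  constructor
  · intro h
    rw [LinearPMap.mem_graph_iff] at h
    obtain ⟨v, rfl, hw⟩ := h
    exact ⟨f.inverse v, (hg _ _).mp (f.inverse.mem_graph v), hw⟩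
  · rintro ⟨y, hy, rfl⟩
    have h := (hg _ _).mpr hy
    rw [LinearPMap.mem_graph_iff] at h
    obtain ⟨v, rfl, hw⟩ := h
    simp only at hw
    subst hw
    exact (absOp D).mem_graph v

/-- `|D|` is self-adjoint. -/
theorem absOp_isSelfAdjoint {D : H →ₗ.[ℂ] H} (hD : IsSelfAdjoint D) :
    IsSelfAdjoint (absOp D) := by
  obtain ⟨hS, hC, hSC, -⟩ := sqrt_facts hD
  have key : ∀ y, ∃ h : CFC.sqrt (invOneAddSq D) y ∈ (absOp D).domain,
      absOp D ⟨_, h⟩ = CFC.sqrt (1 - invOneAddSq D) y := fun y => by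
    have h := (mem_absOp_graph hD).mpr ⟨y, rfl, rfl⟩
    rw [LinearPMap.mem_graph_iff] at h
    obtain ⟨v, hv, hw⟩ := h
    simp only at hv hw
    exact ⟨hv ▸ v.2, by rw [← hw]; congr 1; exact Subtype.ext hv.symm⟩
  have key' : ∀ v : (absOp D).domain, ∃ y, CFC.sqrt (invOneAddSq D) y = v ∧
      CFC.sqrt (1 - invOneAddSq D) y = absOp D v := fun v =>
    (mem_absOp_graph hD).mp ((absOp D).mem_graph v)
  have hdense : Dense ((absOp D).domain : Set H) := by
    rw [Submodule.dense_iff_topologicalClosure_eq_top, Submodule.topologicalClosure_eq_top_iff,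
      eq_bot_iff]
    intro x hx
    rw [Submodule.mem_orthogonal'] at hx
    refine (Submodule.mem_bot ℂ).mpr (sqrt_injective hD ?_)
    have h := hx _ (key (CFC.sqrt (invOneAddSq D) x)).1
    rw [← sqrt_inner, inner_self_eq_zero] at h
    exact h
  have hle : absOp D ≤ (absOp D).adjoint := by
    refine LinearPMap.IsFormalAdjoint.le_adjoint hdense fun v w => ?_
    obtain ⟨a, ha, ha'⟩ := key' v
    obtain ⟨b, hb, hb'⟩ := key' w
    rw [← ha, ← ha', ← hb, ← hb', sqrt_inner, sqrt_inner, hSC]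
  rw [LinearPMap.isSelfAdjoint_def]
  refine le_antisymm (LinearPMap.le_of_le_graph ?_) hle
  rintro ⟨z, w⟩ hzw
  rw [LinearPMap.mem_graph_iff] at hzw
  obtain ⟨v, rfl, rfl⟩ := hzw
  have h1 : CFC.sqrt (1 - invOneAddSq D) (v : H) =
      CFC.sqrt (invOneAddSq D) ((absOp D).adjoint v) := by
    refine ext_inner_right ℂ fun y => ?_
    have h := LinearPMap.adjoint_isFormalAdjoint hdense v ⟨_, (key y).1⟩
    simp only at h
    rw [(key y).2] at h
    rw [sqrt_inner, sqrt_inner]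
    exact h.symm
  rw [mem_absOp_graph hD]
  refine ⟨CFC.sqrt (1 - invOneAddSq D) ((absOp D).adjoint v) + CFC.sqrt (invOneAddSq D) (v : H),
    ?_, ?_⟩
  · rw [map_add, ← hSC, ← h1, hC, hS]; simp
  · rw [map_add, hC, hSC, h1, hS]; simp

/-- `|D|` is positive. -/
theorem absOp_nonneg {D : H →ₗ.[ℂ] H} (hD : IsSelfAdjoint D) (x : (absOp D).domain) :
    0 ≤ RCLike.re ⟪absOp D x, (x : H)⟫_ℂ := by
  obtain ⟨y, hy, hy'⟩ := (mem_absOp_graph hD).mp ((absOp D).mem_graph x)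
  have h := ((ContinuousLinearMap.nonneg_iff_isPositive _).mp
    ((sqrt_facts hD).2.2.2.mul_nonneg (CFC.sqrt_nonneg _) (CFC.sqrt_nonneg _))).re_inner_nonneg_right y
  rw [← hy, ← hy', sqrt_inner]
  exact h

/-- `|D|² = D²`, with equality of domains. -/
theorem absOp_sq {D : H →ₗ.[ℂ] H} (hD : IsSelfAdjoint D) (x z : H) :
    (∃ y, (x, y) ∈ (absOp D).graph ∧ (y, z) ∈ (absOp D).graph) ↔
      ∃ y, (x, y) ∈ D.graph ∧ (y, z) ∈ D.graph := by
  obtain ⟨hS, hC, hSC, -⟩ := sqrt_facts hD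
  have hA := isResolvent_resolvent hD (z := Complex.I) (by simp)
  have hB := isResolvent_star hD
  trans ∃ v, invOneAddSq D v = x ∧ v - invOneAddSq D v = z
  · simp only [mem_absOp_graph hD]
    constructor
    · rintro ⟨_, ⟨a, rfl, rfl⟩, b, hab, rfl⟩
      refine ⟨CFC.sqrt (1 - invOneAddSq D) b + CFC.sqrt (invOneAddSq D) a, ?_, ?_⟩
      · rw [← hS, map_add, ← hSC, hab, hC, hS]; simp
      · rw [← hC, map_add, hSC, ← hab, hC, hS]; simp
    · rintro ⟨v, rfl, rfl⟩
      exact ⟨_, ⟨CFC.sqrt (invOneAddSq D) v, hS v, rfl⟩, CFC.sqrt (1 - invOneAddSq D) v,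
        (hSC v).symm, hC v⟩
  · simp only [LinearPMap.mem_graph_iff]
    constructor
    · rintro ⟨v, rfl, rfl⟩
      obtain ⟨h1, h2⟩ := hA.1 v
      obtain ⟨h3, h4⟩ := hB.1 (resolvent D Complex.I v)
      refine ⟨resolvent D Complex.I v - Complex.I • invOneAddSq D v, ⟨⟨_, h3⟩, rfl, ?_⟩,
        ⟨⟨_, h1⟩ - Complex.I • ⟨_, h3⟩, rfl, ?_⟩⟩
      · rw [sub_eq_iff_eq_add.mp h4, neg_smul, ← sub_eq_add_neg]
        rfl
      · rw [LinearPMap.map_sub, LinearPMap.map_smul, sub_eq_iff_eq_add.mp h2,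
          sub_eq_iff_eq_add.mp h4, smul_add, neg_smul, smul_neg, smul_smul, Complex.I_mul_I]
        simp only [invOneAddSq, mul_apply_eq_comp]
        module
    · rintro ⟨_, ⟨a, rfl, rfl⟩, b, hab, rfl⟩
      have h1 : resolvent D Complex.I (D b + (a : H)) = D a + Complex.I • (a : H) := by
        have h := hA.2 (b + Complex.I • a)
        rw [LinearPMap.map_add, LinearPMap.map_smul] at h
        simp only [Submodule.coe_add, Submodule.coe_smul, hab] at h
        rw [← h]
        congr 1
        rw [smul_add, smul_smul, Complex.I_mul_I]
        module
      have h2 : invOneAddSq D (D b + (a : H)) = a := by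
        have h := hB.2 a
        rw [neg_smul, sub_neg_eq_add, ← h1] at h
        exact h
      exact ⟨_, h2, by rw [h2]; simp⟩

/-! ### Commutators -/

/-- The bounded operator `T` preserves `dom D`, and the commutator `[D, T]`, defined on `dom D`,
extends to the bounded operator `C` (which is unique when `D` is densely defined). -/
def IsCommutator (D : H →ₗ.[ℂ] H) (T C : H →L[ℂ] H) : Prop :=
  ∃ h : ∀ x : D.domain, T x ∈ D.domain, ∀ x : D.domain, C x = D ⟨T x, h x⟩ - T (D x)

/-- `T ∈ dom (δ^k)`, where `δ T` is the bounded extension of `[|D|, T]`, defined on those `T` for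
which it exists. -/
def MemDomDelta (D : H →ₗ.[ℂ] H) : ℕ → (H →L[ℂ] H) → Prop
  | 0, _ => True
  | k + 1, T => ∃ T', IsCommutator (absOp D) T T' ∧ MemDomDelta D k T'

end SpectralTriple

/-! ### Spectral triples -/

/-- A locally compact spectral triple on the Hilbert space `H`, with its summability `s`. -/
structure LocallyCompactSpectralTriple (H : Type u) [NormedAddCommGroup H] [InnerProductSpace ℂ H]
    [CompleteSpace H] [TopologicalSpace.SeparableSpace H] where
  /-- The (possibly non-unital) `*`-algebra of bounded operators. -/
  A : NonUnitalStarSubalgebra ℂ (H →L[ℂ] H)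
  /-- The self-adjoint, possibly unbounded, operator. -/
  D : H →ₗ.[ℂ] H
  isSelfAdjoint_D : IsSelfAdjoint D
  /-- Each `a ∈ A` preserves `dom D`, and `[D, a]` extends to a bounded operator. -/
  exists_isCommutator : ∀ a ∈ A, ∃ C, SpectralTriple.IsCommutator D a C
  /-- The summability of the triple. -/
  s : ℕ
  s_pos : 1 ≤ s
  summable : ∀ a ∈ A,
    a * SpectralTriple.resolvent D Complex.I ^ s ∈ SpectralTriple.schattenClass H 1

namespace LocallyCompactSpectralTriple

variable {H : Type u} [NormedAddCommGroup H] [InnerProductSpace ℂ H] [CompleteSpace H]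
  [TopologicalSpace.SeparableSpace H]

/-- The triple is regular: `a` and `[D, a]` lie in `⋂ k ≥ 1, dom (δ^k)` for all `a ∈ A`. -/
def IsRegular (t : LocallyCompactSpectralTriple H) : Prop :=
  ∀ a ∈ t.A, ∀ C, SpectralTriple.IsCommutator t.D a C →
    ∀ k ≥ 1, SpectralTriple.MemDomDelta t.D k a ∧ SpectralTriple.MemDomDelta t.D k C

/-- Connes' differential one-forms: the finite sums `∑ a j [D, b j]` with `a j, b j ∈ A`. -/
def oneForms (t : LocallyCompactSpectralTriple H) : Set (H →L[ℂ] H) :=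
  {V | ∃ (n : ℕ) (a b C : Fin n → (H →L[ℂ] H)),
    (∀ j, a j ∈ t.A ∧ b j ∈ t.A ∧ SpectralTriple.IsCommutator t.D (b j) (C j)) ∧
      V = ∑ j, a j * C j}

end LocallyCompactSpectralTriple

/-!
Write `R = (D - i)⁻¹`, `R' = (|D| - i)⁻¹` and `P = (1 + D²)⁻¹`, so that `R R⋆ = R' R'⋆ = P`
(`resolvent_mul_star_comm`, `absOp_resolvent_mul_star`). Let `V = ∑ a j C j` with `C j = [D, b j]`.

By regularity `[|D|, C j]` is bounded, so `C j R' = R' E j` with `E j` bounded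
(`IsCommutator.mul_resolvent`) and `V R' = ∑ a j R' E j`. Therefore `(V R) (V R)⋆ = V P V⋆ = (V R')
(V R')⋆` is at most a combination of the operators `a j P (a j)⋆`.

These are compared with the summability assumption by Hansen's inequality: for a contraction `a`,
`a P a⋆ = a (P ^ s) ^ (1 / s) a⋆ ≤ (a P ^ s a⋆) ^ (1 / s)` (`CStarAlgebra.mul_rpow_mul_star_le`).
The `s / 2`-th power of the right-hand side is `(a P ^ s a⋆) ^ (1 / 2) = |(a R ^ s)⋆|`, whose trace
is finite because `a R ^ s` is trace class.

It remains to know two facts on traces of powers of positive operators. First, `T T⋆` and `T⋆ T`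
have the same traces of powers (`ContinuousLinearMap.basisTrace_rpow_mul_star_le`); this is used to
pass from `a R ^ s` to its adjoint and, at the end, from `(V R)⋆` to `V R`. Second, if `0 ≤ y ≤ ∑ z
j` and each `z j ^ q` has finite trace, then so has `y ^ q`
(`ContinuousLinearMap.basisTrace_rpow_ne_top`). For `q ≤ 1` this comes from the operator
monotonicity of powers; for `q ≥ 1` the operator `y` is compact, and the traces are compared on a
basis of its eigenvectors.
-/

/-! ### Functional calculus in C⋆-algebras -/

namespace CStarAlgebra

variable {A : Type*} [CStarAlgebra A] [PartialOrder A] [StarOrderedRing A]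

theorem spectrum_subset_Icc_of_nonneg {x : A} (hx : 0 ≤ x) {M : ℝ} (hM : ‖x‖ ≤ M) :
    spectrum ℝ x ⊆ Set.Icc 0 M := by
  intro t ht
  refine ⟨spectrum_nonneg_of_nonneg hx ht, ?_⟩
  rcases subsingleton_or_nontrivial A with hA | hA
  · simp [spectrum.of_subsingleton] at ht
  exact (le_abs_self t).trans ((spectrum.norm_le_norm_of_mem ht).trans hM)

/-- The functional calculus respects intertwining: if `a x = z a` for positive `x`, `z`, then
`a f(x) = f(z) a`.  This holds for polynomials, hence for their uniform limits. -/
theorem mul_cfc_eq_cfc_mul {a x z : A} (hx : 0 ≤ x) (hz : 0 ≤ z) (h : a * x = z * a) {f : ℝ → ℝ}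
    (hf : ContinuousOn f (Set.Ici 0)) : a * cfc f x = cfc f z * a := by
  obtain ⟨M, hxM, hzM⟩ : ∃ M, ‖x‖ ≤ M ∧ ‖z‖ ≤ M := ⟨max ‖x‖ ‖z‖, le_max_left _ _, le_max_right _ _⟩
  have key : ∀ ε > 0, ‖a * cfc f x - cfc f z * a‖ ≤ ε * (2 * ‖a‖) := by
    intro ε hε
    obtain ⟨p, hp⟩ := exists_polynomial_near_of_continuousOn 0 M f
      (hf.mono Set.Icc_subset_Ici_self) ε hε
    have hclose : ∀ y : A, 0 ≤ y → ‖y‖ ≤ M → ‖cfc f y - Polynomial.aeval y p‖ ≤ ε := by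
      intro y hy hyM
      have hs := spectrum_subset_Icc_of_nonneg hy hyM
      rw [← cfc_polynomial p y, ← cfc_sub f p.eval y
        (hf.mono (hs.trans Set.Icc_subset_Ici_self)) p.continuous.continuousOn]
      refine norm_cfc_le hε.le fun t ht => ?_
      rw [Real.norm_eq_abs, abs_sub_comm]
      exact (hp t (hs ht)).le
    have hpoly : a * Polynomial.aeval x p = Polynomial.aeval z p * a := by
      simp only [Polynomial.aeval_eq_sum_range, Finset.mul_sum, Finset.sum_mul, mul_smul_comm,
        smul_mul_assoc]
      refine Finset.sum_congr rfl fun n _ => ?_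
      rw [(SemiconjBy.pow_right h n : a * x ^ n = z ^ n * a)]
    calc ‖a * cfc f x - cfc f z * a‖
        = ‖a * (cfc f x - Polynomial.aeval x p) - (cfc f z - Polynomial.aeval z p) * a‖ := by
          rw [mul_sub, sub_mul, hpoly]; abel_nf
      _ ≤ ‖a‖ * ε + ε * ‖a‖ := by
          refine (norm_sub_le _ _).trans (add_le_add ?_ ?_)
          · exact (norm_mul_le _ _).trans (by gcongr; exact hclose x hx hxM)
          · exact (norm_mul_le _ _).trans (by gcongr; exact hclose z hz hzM)
      _ = ε * (2 * ‖a‖) := by ring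
  have h0 : Filter.Tendsto (fun ε : ℝ => ε * (2 * ‖a‖)) (nhdsWithin 0 (Set.Ioi 0)) (nhds 0) := by
    have : Filter.Tendsto (fun ε : ℝ => ε * (2 * ‖a‖)) (nhds 0) (nhds (0 * (2 * ‖a‖))) :=
      (continuous_id.mul continuous_const).tendsto 0
    rw [zero_mul] at this
    exact this.mono_left nhdsWithin_le_nhds
  have h1 : ‖a * cfc f x - cfc f z * a‖ ≤ 0 :=
    ge_of_tendsto h0 (Filter.eventually_of_mem self_mem_nhdsWithin fun ε hε => key ε hε)
  exact sub_eq_zero.mp (norm_le_zero_iff.mp h1)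

/-- The function `t ↦ (t + δ) ^ (q - 1)` is operator antitone for `0 ≤ q ≤ 1`: it is the inverse of
the operator monotone `t ↦ (t + δ) ^ (1 - q)`. -/
theorem cfc_add_rpow_anti {q δ : ℝ} (hq : q ∈ Set.Icc (0 : ℝ) 1) (hδ : 0 < δ) {x y : A}
    (hx : 0 ≤ x) (hxy : x ≤ y) :
    cfc (fun t : ℝ => (t + δ) ^ (q - 1)) y ≤ cfc (fun t : ℝ => (t + δ) ^ (q - 1)) x := by
  have h1 : ∀ z : A, 0 ≤ z → IsStrictlyPositive (z + algebraMap ℝ A δ) ∧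
      cfc (fun t : ℝ => (t + δ) ^ (q - 1)) z = (z + algebraMap ℝ A δ) ^ (q - 1) := by
    intro z hz
    have h2 : cfc (fun t : ℝ => t + δ) z = z + algebraMap ℝ A δ := by
      rw [cfc_add_const δ (fun t => t) z, cfc_id' ℝ z]
    refine ⟨?_, ?_⟩
    · have : IsStrictlyPositive (algebraMap ℝ A δ) := by grind
      exact this.of_le (le_add_of_nonneg_left hz)
    · rw [← h2, CFC.cfc_rpow (fun t ht => ?_)]
      have := spectrum_nonneg_of_nonneg hz ht
      positivity
  have hy := hx.trans hxy
  rw [(h1 x hx).2, (h1 y hy).2]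
  set x' := x + algebraMap ℝ A δ
  set y' := y + algebraMap ℝ A δ
  have hx' := (h1 x hx).1
  have hy' := (h1 y hy).1
  have hle : x' ≤ y' := add_le_add_left hxy _
  rcases hq.2.eq_or_lt with rfl | hlt
  · simp [CFC.rpow_zero x' hx'.nonneg, CFC.rpow_zero y' hy'.nonneg]
  have h3 : x' ^ (1 - q) ≤ y' ^ (1 - q) :=
    CFC.rpow_le_rpow ⟨by linarith, by linarith [hq.1]⟩ hle
  have h4 := CStarAlgebra.rpow_neg_one_le_rpow_neg_one h3
    (IsUnit.isStrictlyPositive (hx'.isUnit.cfcRpow _ hx'.nonneg) CFC.rpow_nonneg)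
  rw [CFC.rpow_rpow _ _ _ (by linarith) hx', CFC.rpow_rpow _ _ _ (by linarith) hy'] at h4
  simpa using h4

theorem continuousOn_add_rpow {δ : ℝ} (hδ : 0 < δ) (p : ℝ) :
    ContinuousOn (fun t : ℝ => (t + δ) ^ p) (Set.Ici 0) := by
  refine ContinuousOn.rpow_const (by fun_prop) fun t ht => Or.inl ?_
  have : 0 ≤ t := ht
  positivity

/-- The function `t ↦ t (t + δ) ^ (q - 1)` approximates `t ↦ t ^ q` from below; by
`rpow_sub_le_mul_add_rpow` the error is at most `δ ^ q`, uniformly in `t`.  It is `t` times an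
operator antitone function, and this form is what the trace and conjugation inequalities use. -/
theorem mul_add_rpow_le {q δ t : ℝ} (hq : q ∈ Set.Ioc (0 : ℝ) 1) (hδ : 0 < δ) (ht : 0 ≤ t) :
    t * (t + δ) ^ (q - 1) ≤ t ^ q := by
  rcases ht.eq_or_lt with rfl | ht
  · simp [Real.zero_rpow hq.1.ne']
  calc t * (t + δ) ^ (q - 1) ≤ t * t ^ (q - 1) := by
        gcongr ?_ * ?_
        exact Real.rpow_le_rpow_of_nonpos ht (by linarith) (by linarith [hq.2])
    _ = t ^ q := by rw [Real.rpow_sub_one ht.ne']; field_simp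

theorem rpow_sub_le_mul_add_rpow {q δ t : ℝ} (hq : q ∈ Set.Ioc (0 : ℝ) 1) (hδ : 0 < δ)
    (ht : 0 ≤ t) : t ^ q - δ ^ q ≤ t * (t + δ) ^ (q - 1) := by
  have h1 : t ^ q ≤ (t + δ) ^ q := Real.rpow_le_rpow ht (by linarith) hq.1.le
  have h2 : (t + δ) ^ q = (t + δ) * (t + δ) ^ (q - 1) := by
    rw [Real.rpow_sub_one (by positivity)]; field_simp
  have h3 : δ * (t + δ) ^ (q - 1) ≤ δ ^ q := by
    calc δ * (t + δ) ^ (q - 1) ≤ δ * δ ^ (q - 1) := by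
          gcongr ?_ * ?_
          exact Real.rpow_le_rpow_of_nonpos hδ (by linarith) (by linarith [hq.2])
      _ = δ ^ q := by rw [Real.rpow_sub_one hδ.ne']; field_simp
  nlinarith

theorem spectrum_subset_Ici_of_nonneg {x : A} (hx : 0 ≤ x) : spectrum ℝ x ⊆ Set.Ici 0 :=
  fun _ ht => spectrum_nonneg_of_nonneg hx ht

theorem cfc_mono_of_nonneg {f g : ℝ → ℝ} {x : A} (hx : 0 ≤ x)
    (hf : ContinuousOn f (Set.Ici 0)) (hg : ContinuousOn g (Set.Ici 0))
    (h : ∀ t, 0 ≤ t → f t ≤ g t) : cfc f x ≤ cfc g x :=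
  cfc_mono (fun t ht => h t (spectrum_nonneg_of_nonneg hx ht))
    (hf.mono (spectrum_subset_Ici_of_nonneg hx)) (hg.mono (spectrum_subset_Ici_of_nonneg hx))

theorem continuousOn_rpow {q : ℝ} (hq : 0 ≤ q) : ContinuousOn (fun t : ℝ => t ^ q) (Set.Ici 0) :=
  (Real.continuous_rpow_const hq).continuousOn

theorem cfc_mul_add_rpow_le {q δ : ℝ} (hq : q ∈ Set.Ioc (0 : ℝ) 1) (hδ : 0 < δ) {x : A}
    (hx : 0 ≤ x) : cfc (fun t : ℝ => t * (t + δ) ^ (q - 1)) x ≤ x ^ q := by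
  rw [CFC.rpow_eq_cfc_real]
  exact cfc_mono_of_nonneg hx (continuousOn_id.mul (continuousOn_add_rpow hδ _))
    (continuousOn_rpow hq.1.le) fun t ht => mul_add_rpow_le hq hδ ht

theorem rpow_le_cfc_mul_add_rpow {q δ : ℝ} (hq : q ∈ Set.Ioc (0 : ℝ) 1) (hδ : 0 < δ) {x : A}
    (hx : 0 ≤ x) :
    x ^ q ≤ cfc (fun t : ℝ => t * (t + δ) ^ (q - 1)) x + algebraMap ℝ A (δ ^ q) := by
  have hc : ContinuousOn (fun t : ℝ => t * (t + δ) ^ (q - 1)) (Set.Ici 0) :=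
    continuousOn_id.mul (continuousOn_add_rpow hδ _)
  rw [CFC.rpow_eq_cfc_real, ← cfc_add_const _ _ x (hc.mono (spectrum_subset_Ici_of_nonneg hx))]
  refine cfc_mono_of_nonneg hx (continuousOn_rpow hq.1.le) (hc.add continuousOn_const)
    fun t ht => ?_
  linarith [rpow_sub_le_mul_add_rpow hq hδ ht]

theorem sqrt_mul_cfc_mul_sqrt {x : A} (hx : 0 ≤ x) {f : ℝ → ℝ} (hf : ContinuousOn f (Set.Ici 0)) :
    CFC.sqrt x * cfc f x * CFC.sqrt x = cfc (fun t => t * f t) x := by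
  have h1 : Commute (CFC.sqrt x) x := by
    have := CFC.sqrt_mul_sqrt_self x hx
    rw [Commute, SemiconjBy]
    nth_rw 2 [← this]
    nth_rw 4 [← this]
    rw [mul_assoc]
  have h2 := mul_cfc_eq_cfc_mul hx hx h1.eq hf
  rw [h2, mul_assoc, CFC.sqrt_mul_sqrt_self x hx, cfc_mul _ _ x (by fun_prop)
    (hf.mono (spectrum_subset_Ici_of_nonneg hx)), cfc_id' ℝ x]
  exact (mul_cfc_eq_cfc_mul hx hx rfl hf).symm

/-- `y f(y⋆ y) y⋆ = g(y y⋆)`, where `g t = t f(t)`. -/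
theorem mul_cfc_mul_star (y : A) {f : ℝ → ℝ} (hf : ContinuousOn f (Set.Ici 0)) :
    y * cfc f (star y * y) * star y = cfc (fun t => t * f t) (y * star y) := by
  have h1 := star_mul_self_nonneg y
  have h2 := mul_star_self_nonneg y
  rw [mul_cfc_eq_cfc_mul h1 h2 (mul_assoc _ _ _).symm hf, mul_assoc, cfc_mul _ _ _ (by fun_prop)
    (hf.mono (spectrum_subset_Ici_of_nonneg h2)), cfc_id' ℝ (y * star y)]
  exact (mul_cfc_eq_cfc_mul h2 h2 rfl hf).symm

/-- For `f ≥ 0` the element `k = √f(x)` is self-adjoint, `k k = f(x)`, and `k x k = g(x)`, where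
`g t = t f(t)`. -/
theorem cfc_sqrt_mul_cfc_sqrt {x : A} (hx : 0 ≤ x) {f : ℝ → ℝ} (hf : ContinuousOn f (Set.Ici 0))
    (hf0 : ∀ t, 0 ≤ t → 0 ≤ f t) :
    star (cfc (fun t => √(f t)) x) = cfc (fun t => √(f t)) x ∧
    cfc (fun t => √(f t)) x * cfc (fun t => √(f t)) x = cfc f x ∧
    cfc (fun t => √(f t)) x * x * cfc (fun t => √(f t)) x = cfc (fun t => t * f t) x := by
  have hk : ContinuousOn (fun t => √(f t)) (spectrum ℝ x) :=
    (hf.mono (spectrum_subset_Ici_of_nonneg hx)).sqrt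
  have h2 : cfc (fun t => √(f t)) x * cfc (fun t => √(f t)) x = cfc f x := by
    rw [← cfc_mul _ _ x hk hk]
    exact cfc_congr fun t ht => Real.mul_self_sqrt (hf0 t (spectrum_nonneg_of_nonneg hx ht))
  refine ⟨cfc_predicate (R := ℝ) _ x, h2, ?_⟩
  have h3 := mul_cfc_eq_cfc_mul hx hx rfl hf.sqrt
  rw [← h3, mul_assoc, h2, cfc_mul _ _ x (by fun_prop)
    (hf.mono (spectrum_subset_Ici_of_nonneg hx)), cfc_id' ℝ x]

/-- Hansen's inequality for powers: `a x ^ r a⋆ ≤ (a x a⋆) ^ r` for a contraction `a`, `x ≥ 0` and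
`0 < r ≤ 1`.  Writing `y = a √x`, so that `y⋆ y ≤ x`, it follows from
`y (x + δ) ^ (r - 1) y⋆ ≤ y (y⋆ y + δ) ^ (r - 1) y⋆` as `δ → 0`. -/
theorem mul_rpow_mul_star_le {a x : A} (ha : star a * a ≤ 1) (hx : 0 ≤ x) {r : ℝ}
    (hr : r ∈ Set.Ioc (0 : ℝ) 1) : a * x ^ r * star a ≤ (a * x * star a) ^ r := by
  have hsa : star (CFC.sqrt x) = CFC.sqrt x := (CFC.sqrt_nonneg x).isSelfAdjoint
  set y := a * CFC.sqrt x with hy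
  have hyy : y * star y = a * x * star a := by
    rw [hy, star_mul, hsa, ← mul_assoc, mul_assoc a, CFC.sqrt_mul_sqrt_self x hx]
  have hle : star y * y ≤ x := by
    have h := star_left_conjugate_le_conjugate ha (CFC.sqrt x)
    rw [hsa, mul_one, CFC.sqrt_mul_sqrt_self x hx] at h
    rw [hy, star_mul, hsa]
    simpa [mul_assoc] using h
  have key : ∀ δ : ℝ, 0 < δ → a * x ^ r * star a ≤ (a * x * star a) ^ r + δ ^ r • (a * star a) := by
    intro δ hδ
    have hf := continuousOn_add_rpow hδ (r - 1)
    calc a * x ^ r * star a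
        ≤ a * (cfc (fun t : ℝ => t * (t + δ) ^ (r - 1)) x + algebraMap ℝ A (δ ^ r)) * star a :=
          star_right_conjugate_le_conjugate (rpow_le_cfc_mul_add_rpow hr hδ hx) a
      _ = y * cfc (fun t : ℝ => (t + δ) ^ (r - 1)) x * star y + δ ^ r • (a * star a) := by
          rw [← sqrt_mul_cfc_mul_sqrt hx hf, hy, star_mul, hsa, Algebra.algebraMap_eq_smul_one]
          simp [mul_add, add_mul, mul_assoc]
      _ ≤ y * cfc (fun t : ℝ => (t + δ) ^ (r - 1)) (star y * y) * star y
            + δ ^ r • (a * star a) := by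
          gcongr
          exact star_right_conjugate_le_conjugate (cfc_add_rpow_anti ⟨hr.1.le, hr.2⟩ hδ
            (star_mul_self_nonneg y) hle) y
      _ ≤ (a * x * star a) ^ r + δ ^ r • (a * star a) := by
          rw [mul_cfc_mul_star y hf, hyy]
          gcongr
          exact cfc_mul_add_rpow_le hr hδ (star_right_conjugate_nonneg hx a)
  have hlim : Filter.Tendsto (fun δ : ℝ => (a * x * star a) ^ r + δ ^ r • (a * star a))
      (nhdsWithin 0 (Set.Ioi 0)) (nhds ((a * x * star a) ^ r)) := by
    have h1 : Continuous fun δ : ℝ => (a * x * star a) ^ r + δ ^ r • (a * star a) :=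
      continuous_const.add ((Real.continuous_rpow_const hr.1.le).smul continuous_const)
    have h2 := h1.tendsto 0
    rw [Real.zero_rpow hr.1.ne', zero_smul, add_zero] at h2
    exact h2.mono_left nhdsWithin_le_nhds
  exact ge_of_tendsto hlim (Filter.eventually_of_mem self_mem_nhdsWithin key)

theorem smul_rpow {c : ℝ} (hc : 0 ≤ c) {x : A} (hx : 0 ≤ x) {q : ℝ} (hq : 0 ≤ q) :
    (c • x) ^ q = c ^ q • x ^ q := by
  have h1 : 0 ≤ c • x := smul_nonneg hc hx
  rw [CFC.rpow_eq_cfc_real h1, CFC.rpow_eq_cfc_real hx,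
    ← cfc_comp_smul c (fun t : ℝ => t ^ q) x (Real.continuous_rpow_const hq).continuousOn,
    ← cfc_smul (c ^ q) (fun t : ℝ => t ^ q) x (Real.continuous_rpow_const hq).continuousOn]
  refine cfc_congr fun t ht => ?_
  exact Real.mul_rpow hc (spectrum_nonneg_of_nonneg hx ht)

theorem sum_mul_star_sum_le {κ : Type*} (s : Finset κ) (x : κ → A) :
    (∑ j ∈ s, x j) * star (∑ j ∈ s, x j) ≤ (s.card : ℝ) • ∑ j ∈ s, x j * star (x j) := by
  -- Twice the difference of the two sides is the double sum of `(x i - x j) (x i - x j)⋆`.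
  have h : (0 : A) ≤ ∑ i ∈ s, ∑ j ∈ s, (x i - x j) * star (x i - x j) :=
    Finset.sum_nonneg fun i _ => Finset.sum_nonneg fun j _ => mul_star_self_nonneg _
  have h1 : ∑ i ∈ s, ∑ j ∈ s, (x i - x j) * star (x i - x j) =
      (2 : ℝ) • ((s.card : ℝ) • ∑ j ∈ s, x j * star (x j) -
        (∑ j ∈ s, x j) * star (∑ j ∈ s, x j)) := by
    simp only [star_sub, sub_mul, mul_sub, Finset.sum_sub_distrib, Finset.sum_const, star_sum,
      ← Finset.mul_sum, ← Finset.sum_mul, ← Finset.smul_sum, Nat.cast_smul_eq_nsmul]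
    module
  rw [h1] at h
  have h2 := smul_nonneg (show (0 : ℝ) ≤ 2⁻¹ by norm_num) h
  rw [smul_smul, inv_mul_cancel₀ two_ne_zero, one_smul] at h2
  exact sub_nonneg.mp h2

theorem pow_nonneg_of_nonneg {x : A} (hx : 0 ≤ x) (n : ℕ) : 0 ≤ x ^ n := by
  rw [← CFC.rpow_natCast x n hx]
  exact CFC.rpow_nonneg

/-- Hansen's inequality at `x ^ s` with exponent `1 / s`, for an `a` that need not be a contraction:
it is rescaled by `‖a‖ + 1`, which avoids the case `a = 0`. -/
theorem mul_mul_star_le_smul_rpow (a : A) {x : A} (hx : 0 ≤ x) {s : ℕ} (hs : 1 ≤ s) :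
    a * x * star a ≤ (‖a‖ + 1) ^ 2 •
      ((((‖a‖ + 1)⁻¹ : ℝ) • a) * x ^ s * star (((‖a‖ + 1)⁻¹ : ℝ) • a)) ^ (1 / s : ℝ) := by
  have hs' : (1 : ℝ) ≤ s := by exact_mod_cast hs
  have hκ : 0 < ‖a‖ + 1 := by positivity
  set d := ((‖a‖ + 1)⁻¹ : ℝ) • a with hd
  have hdn : ‖d‖ ≤ 1 := by
    rw [hd, norm_smul, Real.norm_of_nonneg (by positivity), inv_mul_le_iff₀ hκ]
    linarith
  have hd1 : star d * d ≤ 1 := by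
    refine (CStarAlgebra.norm_le_one_iff_of_nonneg _ (star_mul_self_nonneg d)).mp ?_
    rw [CStarRing.norm_star_mul_self]
    nlinarith [norm_nonneg d]
  have hxs : (x ^ s) ^ (1 / s : ℝ) = x := by
    rw [← CFC.rpow_natCast x s hx, CFC.rpow_rpow_of_exponent_nonneg _ _ _ (by positivity)
      (by positivity) hx, mul_one_div_cancel (by positivity), CFC.rpow_one x hx]
  have h := mul_rpow_mul_star_le hd1 (pow_nonneg_of_nonneg hx s) (r := 1 / s)
    ⟨by positivity, by rw [div_le_one (by positivity)]; exact hs'⟩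
  rw [hxs] at h
  calc a * x * star a = (‖a‖ + 1) ^ 2 • (d * x * star d) := by
        rw [hd, star_smul, star_trivial ((‖a‖ + 1)⁻¹), smul_mul_assoc, smul_mul_assoc,
          mul_smul_comm, smul_smul, smul_smul,
          show (‖a‖ + 1) ^ 2 * (‖a‖ + 1)⁻¹ * (‖a‖ + 1)⁻¹ = 1 by field_simp, one_smul]
    _ ≤ _ := smul_le_smul_of_nonneg_left h (by positivity)

end CStarAlgebra

/-! ### Traces of positive operators -/

namespace ContinuousLinearMap

open scoped ENNReal

variable {H : Type u} [NormedAddCommGroup H] [InnerProductSpace ℂ H] {ι κ ι' : Type*}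

/-- The trace `∑ ⟨b i, T (b i)⟩ ∈ [0, ∞]` of a positive operator `T` along a Hilbert basis `b`; for
other operators, negative terms are replaced by `0`. -/
noncomputable def basisTrace (b : HilbertBasis ι ℂ H) (T : H →L[ℂ] H) : ℝ≥0∞ :=
  ∑' i, ENNReal.ofReal (RCLike.re ⟪b i, T (b i)⟫_ℂ)

theorem re_inner_mono {S T : H →L[ℂ] H} (h : S ≤ T) (x : H) :
    RCLike.re ⟪x, S x⟫_ℂ ≤ RCLike.re ⟪x, T x⟫_ℂ := by
  have h1 := ((ContinuousLinearMap.le_def _ _).mp h).re_inner_nonneg_right x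
  rw [sub_apply, inner_sub_right, map_sub] at h1
  linarith

theorem basisTrace_mono (b : HilbertBasis ι ℂ H) {S T : H →L[ℂ] H} (h : S ≤ T) :
    basisTrace b S ≤ basisTrace b T :=
  ENNReal.tsum_le_tsum fun i => ENNReal.ofReal_le_ofReal (re_inner_mono h (b i))

theorem basisTrace_add_le (b : HilbertBasis ι ℂ H) (S T : H →L[ℂ] H) :
    basisTrace b (S + T) ≤ basisTrace b S + basisTrace b T := by
  rw [basisTrace, basisTrace, basisTrace, ← ENNReal.tsum_add]
  refine ENNReal.tsum_le_tsum fun i => ?_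
  rw [add_apply, inner_add_right, map_add]
  exact ENNReal.ofReal_add_le

theorem basisTrace_zero (b : HilbertBasis ι ℂ H) : basisTrace b (0 : H →L[ℂ] H) = 0 := by
  simp [basisTrace]

theorem basisTrace_sum_le (b : HilbertBasis ι ℂ H) (s : Finset κ) (T : κ → H →L[ℂ] H) :
    basisTrace b (∑ j ∈ s, T j) ≤ ∑ j ∈ s, basisTrace b (T j) :=
  Finset.le_sum_of_subadditive _ (basisTrace_zero b).le (basisTrace_add_le b) _ _

theorem basisTrace_smul (b : HilbertBasis ι ℂ H) {c : ℝ} (hc : 0 ≤ c) (T : H →L[ℂ] H) :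
    basisTrace b (c • T) = ENNReal.ofReal c * basisTrace b T := by
  rw [basisTrace, basisTrace, ← ENNReal.tsum_mul_left]
  refine tsum_congr fun i => ?_
  rw [← ENNReal.ofReal_mul hc, smul_apply, inner_smul_right_eq_smul, RCLike.smul_re]

/-- Parseval's identity in `[0, ∞]`. -/
theorem ofReal_norm_sq_eq_tsum (b : HilbertBasis ι ℂ H) (x : H) :
    ENNReal.ofReal (‖x‖ ^ 2) = ∑' i, ENNReal.ofReal (‖⟪b i, x⟫_ℂ‖ ^ 2) := by
  have h := (b.hasSum_inner_mul_inner x x).mapL RCLike.reCLM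
  have h1 : ∀ i, RCLike.reCLM (⟪x, b i⟫_ℂ * ⟪b i, x⟫_ℂ) = ‖⟪b i, x⟫_ℂ‖ ^ 2 := by
    intro i
    rw [RCLike.reCLM_apply, inner_mul_symm_re_eq_norm, norm_mul, norm_inner_symm, sq]
  simp only [h1] at h
  rw [RCLike.reCLM_apply, inner_self_eq_norm_sq] at h
  rw [← h.tsum_eq, ENNReal.ofReal_tsum_of_nonneg (fun i => by positivity) h.summable]

/-- The bound `Tr S ≤ K` survives a limit in which `T ≤ S + ε` with `ε → 0`, although the trace of
`ε` is infinite: only finite partial sums are compared. -/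
theorem basisTrace_le_of_forall_le_add (b : HilbertBasis ι ℂ H) {T : H →L[ℂ] H} {K : ℝ≥0∞}
    (h : ∀ ε : ℝ, 0 < ε → ∃ S : H →L[ℂ] H, T ≤ S + algebraMap ℝ (H →L[ℂ] H) ε ∧
      basisTrace b S ≤ K) : basisTrace b T ≤ K := by
  rw [basisTrace, ENNReal.tsum_eq_iSup_sum]
  refine iSup_le fun F => ?_
  have key : ∀ ε : ℝ, 0 < ε → ∑ i ∈ F, ENNReal.ofReal (RCLike.re ⟪b i, T (b i)⟫_ℂ) ≤
      K + ENNReal.ofReal (F.card * ε) := by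
    intro ε hε
    obtain ⟨S, hS, hK⟩ := h ε hε
    calc ∑ i ∈ F, ENNReal.ofReal (RCLike.re ⟪b i, T (b i)⟫_ℂ)
        ≤ ∑ i ∈ F, (ENNReal.ofReal (RCLike.re ⟪b i, S (b i)⟫_ℂ) + ENNReal.ofReal ε) := by
          refine Finset.sum_le_sum fun i _ => ?_
          refine le_trans (ENNReal.ofReal_le_ofReal ?_) ENNReal.ofReal_add_le
          refine (re_inner_mono hS (b i)).trans_eq ?_
          rw [Algebra.algebraMap_eq_smul_one, add_apply, inner_add_right, map_add, smul_apply,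
            inner_smul_right_eq_smul, RCLike.smul_re, one_apply_eq_self,
            inner_self_eq_norm_sq, b.orthonormal.norm_eq_one]
          simp
      _ ≤ K + ENNReal.ofReal (F.card * ε) := by
          rw [Finset.sum_add_distrib, Finset.sum_const, nsmul_eq_mul,
            ENNReal.ofReal_mul (by positivity), ENNReal.ofReal_natCast]
          gcongr
          exact (ENNReal.sum_le_tsum F).trans hK
  have hlim : Filter.Tendsto (fun ε : ℝ => K + ENNReal.ofReal (F.card * ε))
      (nhdsWithin 0 (Set.Ioi 0)) (nhds K) := by
    have h1 : Continuous fun ε : ℝ => K + ENNReal.ofReal (F.card * ε) :=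
      continuous_const.add (ENNReal.continuous_ofReal.comp (by fun_prop))
    have h2 := h1.tendsto 0
    rw [mul_zero, ENNReal.ofReal_zero, add_zero] at h2
    exact h2.mono_left nhdsWithin_le_nhds
  exact ge_of_tendsto hlim (Filter.eventually_of_mem self_mem_nhdsWithin key)

variable [CompleteSpace H]

theorem basisTrace_star_mul_self (b : HilbertBasis ι ℂ H) (W : H →L[ℂ] H) :
    basisTrace b (star W * W) = ∑' i, ENNReal.ofReal (‖W (b i)‖ ^ 2) := by
  refine tsum_congr fun i => ?_
  rw [mul_apply_eq_comp, star_eq_adjoint, adjoint_inner_right, inner_self_eq_norm_sq]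

/-- Cyclicity of the trace; in particular the trace of a positive operator does not depend on the
basis. -/
theorem basisTrace_star_mul_self_comm (b : HilbertBasis ι ℂ H) (c : HilbertBasis κ ℂ H)
    (W : H →L[ℂ] H) : basisTrace b (star W * W) = basisTrace c (W * star W) := by
  have h := basisTrace_star_mul_self c (star W)
  rw [star_star] at h
  rw [h, basisTrace_star_mul_self]
  simp_rw [ofReal_norm_sq_eq_tsum c (W _), ofReal_norm_sq_eq_tsum b (star W _)]
  rw [ENNReal.tsum_comm]
  refine tsum_congr fun i => tsum_congr fun j => ?_
  rw [star_eq_adjoint, adjoint_inner_right, norm_inner_symm]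

theorem basisTrace_eq_of_nonneg (b : HilbertBasis ι ℂ H) (c : HilbertBasis κ ℂ H)
    {T : H →L[ℂ] H} (hT : 0 ≤ T) : basisTrace b T = basisTrace c T := by
  have hs : star (CFC.sqrt T) = CFC.sqrt T := (CFC.sqrt_nonneg T).isSelfAdjoint
  have h := basisTrace_star_mul_self_comm b c (CFC.sqrt T)
  rwa [hs, CFC.sqrt_mul_sqrt_self T hT] at h

/-- The operators `y y⋆` and `y⋆ y` have the same traces of powers (stated as an inequality, to be
applied to `y` and `y⋆`).  For `W = y √f(y⋆ y)` with `f t = t ^ q / max t δ`, cyclicity compares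
`W W⋆ = g(y y⋆)` with `W⋆ W = g(y⋆ y)`, where `g t = t f(t)` is within `δ ^ q` of `t ^ q`; the
cut-off `δ` takes the place of a polar decomposition. -/
theorem basisTrace_rpow_mul_star_le (b : HilbertBasis ι ℂ H) (c : HilbertBasis κ ℂ H)
    (y : H →L[ℂ] H) {q : ℝ} (hq : 0 < q) :
    basisTrace c ((y * star y) ^ q) ≤ basisTrace b ((star y * y) ^ q) := by
  have h1 := star_mul_self_nonneg y
  have h2 := mul_star_self_nonneg y
  refine basisTrace_le_of_forall_le_add c fun ε hε => ?_
  obtain ⟨δ, hδ, rfl⟩ : ∃ δ : ℝ, 0 < δ ∧ δ ^ q = ε :=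
    ⟨ε ^ q⁻¹, by positivity, Real.rpow_inv_rpow hε.le hq.ne'⟩
  set f : ℝ → ℝ := fun t => t ^ q / max t δ with hfdef
  have hpos : ∀ t : ℝ, 0 < max t δ := fun t => lt_max_of_lt_right hδ
  have hf : ContinuousOn f (Set.Ici 0) :=
    ((Real.continuous_rpow_const hq.le).div (by fun_prop) fun t => (hpos t).ne').continuousOn
  have hf0 : ∀ t, 0 ≤ t → 0 ≤ f t := fun t ht => div_nonneg (by positivity) (hpos t).le
  have hc : ContinuousOn (fun t => t * f t) (Set.Ici 0) := continuousOn_id.mul hf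
  obtain ⟨hk1, hk2, hk3⟩ := CStarAlgebra.cfc_sqrt_mul_cfc_sqrt h1 hf hf0
  set k := cfc (fun t => √(f t)) (star y * y)
  have hWW : y * k * star (y * k) = cfc (fun t => t * f t) (y * star y) := by
    rw [star_mul, hk1, ← CStarAlgebra.mul_cfc_mul_star y hf, ← hk2]
    simp only [mul_assoc]
  have hWW' : star (y * k) * (y * k) = cfc (fun t => t * f t) (star y * y) := by
    rw [star_mul, hk1, ← hk3]
    simp only [mul_assoc]
  refine ⟨cfc (fun t => t * f t) (y * star y), ?_, ?_⟩
  · rw [CFC.rpow_eq_cfc_real h2, ← cfc_add_const _ _ _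
      (hc.mono (CStarAlgebra.spectrum_subset_Ici_of_nonneg h2))]
    refine CStarAlgebra.cfc_mono_of_nonneg h2 (CStarAlgebra.continuousOn_rpow hq.le)
      (hc.add continuousOn_const) fun t ht => ?_
    rcases le_total δ t with hle | hle
    · have : 0 < t := hδ.trans_le hle
      have h3 : t * f t = t ^ q := by simp only [hfdef, max_eq_left hle]; field_simp
      rw [h3]
      have : 0 ≤ δ ^ q := by positivity
      linarith
    · have h3 : t ^ q ≤ δ ^ q := Real.rpow_le_rpow ht hle hq.le
      have := mul_nonneg ht (hf0 t ht)
      linarith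
  · rw [← hWW, ← basisTrace_star_mul_self_comm b c, hWW']
    refine basisTrace_mono b ?_
    rw [CFC.rpow_eq_cfc_real h1]
    refine CStarAlgebra.cfc_mono_of_nonneg h1 hc (CStarAlgebra.continuousOn_rpow hq.le)
      fun t ht => ?_
    simp only [hfdef]
    rw [mul_div_assoc', div_le_iff₀ (hpos t), mul_comm]
    gcongr
    exact le_max_left _ _

/-- Rotfel'd's inequality: `Tr y ^ q ≤ ∑ Tr (z j) ^ q` if `y ≤ ∑ z j` and `0 < q ≤ 1`.  With
`x = ∑ z j`, cyclicity turns `Tr x (x + δ) ^ (q - 1)` into the sum of the traces of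
`√(z j) (x + δ) ^ (q - 1) √(z j) ≤ √(z j) (z j + δ) ^ (q - 1) √(z j)`. -/
theorem basisTrace_rpow_le_sum (b : HilbertBasis ι ℂ H) {q : ℝ} (hq : q ∈ Set.Ioc (0 : ℝ) 1)
    (s : Finset κ) {z : κ → H →L[ℂ] H} (hz : ∀ j ∈ s, 0 ≤ z j) {y : H →L[ℂ] H}
    (hyz : y ≤ ∑ j ∈ s, z j) : basisTrace b (y ^ q) ≤ ∑ j ∈ s, basisTrace b (z j ^ q) := by
  set x := ∑ j ∈ s, z j with hxdef
  have hx : 0 ≤ x := Finset.sum_nonneg hz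
  refine (basisTrace_mono b (CFC.rpow_le_rpow ⟨hq.1.le, hq.2⟩ hyz)).trans ?_
  refine basisTrace_le_of_forall_le_add b fun ε hε => ?_
  obtain ⟨δ, hδ, rfl⟩ : ∃ δ : ℝ, 0 < δ ∧ δ ^ q = ε :=
    ⟨ε ^ q⁻¹, by positivity, Real.rpow_inv_rpow hε.le hq.1.ne'⟩
  refine ⟨_, CStarAlgebra.rpow_le_cfc_mul_add_rpow hq hδ hx, ?_⟩
  have hf := CStarAlgebra.continuousOn_add_rpow hδ (q - 1)
  obtain ⟨hk1, hk2, hk3⟩ := CStarAlgebra.cfc_sqrt_mul_cfc_sqrt hx hf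
    fun t ht => Real.rpow_nonneg (add_nonneg ht hδ.le) _
  rw [← hk3]
  set k := cfc (fun t : ℝ => √((t + δ) ^ (q - 1))) x
  rw [hxdef, Finset.mul_sum, Finset.sum_mul]
  refine (basisTrace_sum_le b s _).trans (Finset.sum_le_sum fun j hj => ?_)
  have hzj := hz j hj
  have hs : star (CFC.sqrt (z j)) = CFC.sqrt (z j) := (CFC.sqrt_nonneg _).isSelfAdjoint
  have h3 : k * z j * k = star (CFC.sqrt (z j) * k) * (CFC.sqrt (z j) * k) := by
    rw [star_mul, hk1, hs]
    nth_rw 1 [← CFC.sqrt_mul_sqrt_self (z j) hzj]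
    simp only [mul_assoc]
  have h4 : CFC.sqrt (z j) * k * star (CFC.sqrt (z j) * k) =
      CFC.sqrt (z j) * cfc (fun t : ℝ => (t + δ) ^ (q - 1)) x * star (CFC.sqrt (z j)) := by
    rw [star_mul, hk1, ← hk2]
    simp only [mul_assoc]
  rw [h3, basisTrace_star_mul_self_comm b b, h4]
  refine basisTrace_mono b ?_
  calc CFC.sqrt (z j) * cfc (fun t : ℝ => (t + δ) ^ (q - 1)) x * star (CFC.sqrt (z j))
      ≤ CFC.sqrt (z j) * cfc (fun t : ℝ => (t + δ) ^ (q - 1)) (z j) * star (CFC.sqrt (z j)) :=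
        star_right_conjugate_le_conjugate (CStarAlgebra.cfc_add_rpow_anti ⟨hq.1.le, hq.2⟩ hδ hzj
          (Finset.single_le_sum hz hj)) _
    _ = cfc (fun t : ℝ => t * (t + δ) ^ (q - 1)) (z j) := by
        rw [hs, CStarAlgebra.sqrt_mul_cfc_mul_sqrt hzj hf]
    _ ≤ z j ^ q := CStarAlgebra.cfc_mul_add_rpow_le hq hδ hzj

/-! ### Compactness and monotonicity of traces of powers -/

/-- A compact symmetric operator has a Hilbert basis of eigenvectors. -/
theorem exists_hilbertBasis_eigenvectors {T : H →L[ℂ] H} (hT : IsCompactOperator T)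
    (hT' : (T : H →ₗ[ℂ] H).IsSymmetric) :
    ∃ (ι : Type u) (b : HilbertBasis ι ℂ H) (μ : ι → ℂ), ∀ i, T (b i) = μ i • b i := by
  let E : ℂ → Submodule ℂ H := fun μ => Module.End.eigenspace (T : Module.End ℂ H) μ
  have hcl : ∀ μ, IsClosed (E μ : Set H) := by
    intro μ
    have : (E μ : Set H) = {x | T x = μ • x} := by
      ext x; exact Module.End.mem_eigenspace_iff
    rw [this]
    exact isClosed_eq T.continuous (continuous_const_smul μ)
  have hcomp : ∀ μ, CompleteSpace (E μ) := fun μ => (hcl μ).completeSpace_coe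
  choose w b hb using fun μ => exists_hilbertBasis ℂ (E μ)
  have horth : OrthogonalFamily ℂ (fun μ => E μ) fun μ => (E μ).subtypeₗᵢ :=
    hT'.orthogonalFamily_eigenspaces
  let v : (Σ μ, w μ) → H := fun a => ((b a.1 a.2 : E a.1) : H)
  have hv : Orthonormal ℂ v :=
    horth.orthonormal_sigma_orthonormal (fun μ => (b μ).orthonormal)
  have hspan : (Submodule.span ℂ (Set.range v))ᗮ = ⊥ := by
    rw [eq_bot_iff, ← T.orthogonalComplement_iSup_eigenspaces_eq_bot hT hT']
    intro x hx
    rw [← Submodule.iInf_orthogonal, Submodule.mem_iInf]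
    intro μ
    rw [Submodule.mem_orthogonal]
    intro y hy
    have h1 : Submodule.span ℂ (Set.range (b μ)) ≤
        (LinearMap.ker (innerSL ℂ x).toLinearMap).comap (E μ).subtype := by
      rw [Submodule.span_le]
      rintro _ ⟨i, rfl⟩
      have := (Submodule.mem_orthogonal' _ _).mp hx (v ⟨μ, i⟩)
        (Submodule.subset_span ⟨⟨μ, i⟩, rfl⟩)
      simpa using this
    have h2 := Submodule.topologicalClosure_minimal _ h1 (by
      have : IsClosed ((E μ).subtype ⁻¹' (LinearMap.ker (innerSL ℂ x).toLinearMap : Set H)) :=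
        ((innerSL ℂ x).isClosed_ker).preimage continuous_subtype_val
      exact this)
    rw [(b μ).dense_span] at h2
    have h3 := h2 (Submodule.mem_top (x := (⟨y, hy⟩ : E μ)))
    rw [inner_eq_zero_symm]
    simpa using h3
  refine ⟨_, HilbertBasis.mkOfOrthogonalEqBot hv hspan, fun a => a.1, fun a => ?_⟩
  rw [HilbertBasis.coe_mkOfOrthogonalEqBot]
  exact Module.End.mem_eigenspace_iff.mp (b a.1 a.2).2

/-- The Hilbert–Schmidt norm dominates the operator norm. -/
theorem norm_sq_le_basisTrace (b : HilbertBasis ι ℂ H) (W : H →L[ℂ] H) :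
    ENNReal.ofReal (‖W‖ ^ 2) ≤ basisTrace b (star W * W) := by
  rcases eq_or_ne (basisTrace b (star W * W)) ⊤ with h | h
  · simp [h]
  rw [ENNReal.ofReal_le_iff_le_toReal h, ← norm_star]
  set K := (basisTrace b (star W * W)).toReal
  have hK : 0 ≤ K := ENNReal.toReal_nonneg
  refine (Real.le_sqrt (norm_nonneg _) hK).mp (opNorm_le_bound _ (Real.sqrt_nonneg _) fun y => ?_)
  rw [← Real.sqrt_sq (norm_nonneg y), ← Real.sqrt_mul hK]
  refine Real.le_sqrt_of_sq_le ?_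
  have h1 : ENNReal.ofReal (‖star W y‖ ^ 2) ≤ ENNReal.ofReal (‖y‖ ^ 2) *
      basisTrace b (star W * W) := by
    rw [ofReal_norm_sq_eq_tsum b, basisTrace_star_mul_self, ← ENNReal.tsum_mul_left]
    refine ENNReal.tsum_le_tsum fun i => ?_
    rw [← ENNReal.ofReal_mul (by positivity), star_eq_adjoint, adjoint_inner_right]
    refine ENNReal.ofReal_le_ofReal ?_
    rw [← mul_pow, mul_comm]
    gcongr
    exact norm_inner_le_norm _ _
  rw [← ENNReal.ofReal_toReal h, ← ENNReal.ofReal_mul (by positivity)] at h1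
  rw [mul_comm]
  exact (ENNReal.ofReal_le_ofReal_iff (by positivity)).mp h1

/-- A positive operator that is, up to arbitrarily small multiples of the identity, dominated by
operators of finite trace is compact. -/
theorem isCompactOperator_of_forall_le_add (b : HilbertBasis ι ℂ H) {y : H →L[ℂ] H} (hy : 0 ≤ y)
    (h : ∀ ε : ℝ, 0 < ε → ∃ g : H →L[ℂ] H, 0 ≤ g ∧ basisTrace b g ≠ ⊤ ∧
      y ≤ algebraMap ℝ (H →L[ℂ] H) ε + g) : IsCompactOperator y := by
  have hsy : star (CFC.sqrt y) = CFC.sqrt y := (CFC.sqrt_nonneg y).isSelfAdjoint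
  suffices hc : IsCompactOperator ⇑(CFC.sqrt y : H →L[ℂ] H) by
    rw [← CFC.sqrt_mul_sqrt_self y hy]
    exact hc.clm_comp (CFC.sqrt y)
  have hclosed := isClosed_setOfPred_isCompactOperator (𝕜₁ := ℂ) (𝕜₂ := ℂ) (M₁ := H) (M₂ := H)
    (σ₁₂ := RingHom.id ℂ)
  suffices hmem : CFC.sqrt y ∈ closure {T : H →L[ℂ] H | IsCompactOperator T} from
    hclosed.closure_subset hmem
  refine Metric.mem_closure_iff.mpr fun r hr => ?_
  obtain ⟨g, hg, htr, hle⟩ := h (r ^ 2 / 4) (by positivity)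
  have hsg : star (CFC.sqrt g) = CFC.sqrt g := (CFC.sqrt_nonneg g).isSelfAdjoint
  have hgg : star (CFC.sqrt g) * CFC.sqrt g = g := by rw [hsg, CFC.sqrt_mul_sqrt_self g hg]
  -- With `P` the projection onto finitely many basis vectors, `√y P` has finite rank and is within
  -- `r` of `√y`, because `(1 - P) g (1 - P)` has small trace.
  obtain ⟨F, hF⟩ := ((ENNReal.tendsto_tsum_compl_atTop_zero htr).eventually
    (gt_mem_nhds (ENNReal.ofReal_pos.mpr (show 0 < r ^ 2 / 4 by positivity)))).exists
  let U : Submodule ℂ H := Submodule.span ℂ (b '' F)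
  have hfin : FiniteDimensional ℂ U := FiniteDimensional.span_of_finite ℂ (F.finite_toSet.image b)
  let P : H →L[ℂ] H := U.starProjection
  have hPc : IsCompactOperator P := by
    have : ProperSpace U := FiniteDimensional.proper ℂ U
    have h1 : IsCompactOperator ⇑(U.orthogonalProjectionOnto : H →L[ℂ] U) :=
      isCompactOperator_of_locallyCompactSpace_dom _
    exact h1.clm_comp U.subtypeL
  have hP : star (1 - P) = 1 - P := by
    rw [star_sub, star_one]
    congr 1
    exact (isSelfAdjoint_starProjection U)
  have hPin : ∀ i ∈ F, (1 - P) (b i) = 0 := by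
    intro i hi
    rw [sub_apply, one_apply_eq_self, sub_eq_zero]
    have hiU : b i ∈ U := Submodule.subset_span ⟨i, hi, rfl⟩
    exact (Submodule.starProjection_eq_self_iff.mpr hiU).symm
  have hPout : ∀ i ∉ F, (1 - P) (b i) = b i := by
    intro i hi
    rw [sub_apply, one_apply_eq_self, sub_eq_self]
    refine U.starProjection_apply_eq_zero_iff.mpr ((Submodule.mem_orthogonal _ _).mpr ?_)
    intro u (hu : u ∈ Submodule.span ℂ (b '' F))
    induction hu using Submodule.span_induction with
    | mem x hx =>
      obtain ⟨j, hj, rfl⟩ := hx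
      exact b.orthonormal.inner_eq_zero fun h => hi (h ▸ hj)
    | zero => simp
    | add x y _ _ hx hy => rw [inner_add_left, hx, hy, add_zero]
    | smul a x _ hx => rw [inner_smul_left, hx, mul_zero]
  have htail : basisTrace b ((1 - P) * g * (1 - P)) ≤ ENNReal.ofReal (r ^ 2 / 4) := by
    have h1 : (1 - P) * g * (1 - P) = star (CFC.sqrt g * (1 - P)) * (CFC.sqrt g * (1 - P)) := by
      nth_rw 1 [← hgg]
      rw [star_mul, hP]
      simp only [mul_assoc]
    refine le_trans ?_ hF.le
    rw [h1, basisTrace_star_mul_self]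
    refine le_of_le_of_eq ?_ (tsum_subtype {i | i ∉ F}
      (fun i => ENNReal.ofReal (RCLike.re ⟪b i, g (b i)⟫_ℂ))).symm
    refine ENNReal.tsum_le_tsum fun i => ?_
    rw [mul_apply_eq_comp]
    by_cases hi : i ∈ F
    · simp [hPin i hi]
    · rw [hPout i hi, Set.indicator_of_mem (show i ∈ {i | i ∉ F} from hi)]
      nth_rw 2 [← hgg]
      rw [mul_apply_eq_comp, star_eq_adjoint, adjoint_inner_right, inner_self_eq_norm_sq]
  have hnorm : ‖CFC.sqrt y * (1 - P)‖ ^ 2 ≤ r ^ 2 / 2 := by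
    have hg1 : ‖CFC.sqrt g * (1 - P)‖ ^ 2 ≤ r ^ 2 / 4 := by
      have h1 := (norm_sq_le_basisTrace b (CFC.sqrt g * (1 - P))).trans_eq (by
        rw [star_mul, hP, mul_assoc, ← mul_assoc (star (CFC.sqrt g)), hgg, ← mul_assoc])
      exact (ENNReal.ofReal_le_ofReal_iff (by positivity)).mp (h1.trans htail)
    refine (Real.le_sqrt (norm_nonneg _) (by positivity)).mp
      (opNorm_le_bound _ (Real.sqrt_nonneg _) fun x => ?_)
    rw [← Real.sqrt_sq (norm_nonneg x), ← Real.sqrt_mul (by positivity)]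
    refine Real.le_sqrt_of_sq_le ?_
    set v := (1 - P) x with hvdef
    have hv : ‖v‖ ≤ ‖x‖ := by
      have h1 : v = Uᗮ.starProjection x := by rw [Submodule.starProjection_orthogonal]; rfl
      rw [h1]
      exact Uᗮ.norm_starProjection_apply_le x
    have hyv : ‖CFC.sqrt y v‖ ^ 2 = RCLike.re ⟪v, y v⟫_ℂ := by
      rw [← inner_self_eq_norm_sq (𝕜 := ℂ), ← adjoint_inner_right, ← star_eq_adjoint, hsy,
        ← mul_apply_eq_comp, CFC.sqrt_mul_sqrt_self y hy]
    have hgv : RCLike.re ⟪v, g v⟫_ℂ = ‖(CFC.sqrt g * (1 - P)) x‖ ^ 2 := by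
      have h5 : star (CFC.sqrt g) (CFC.sqrt g v) = g v := congrArg (fun T : H →L[ℂ] H => T v) hgg
      rw [mul_apply_eq_comp, ← hvdef, ← inner_self_eq_norm_sq (𝕜 := ℂ),
        ← adjoint_inner_right (CFC.sqrt g), ← star_eq_adjoint, h5]
    have h2 := re_inner_mono hle v
    rw [add_apply, inner_add_right, map_add, Algebra.algebraMap_eq_smul_one, smul_apply,
      inner_smul_right_eq_smul, RCLike.smul_re, one_apply_eq_self, inner_self_eq_norm_sq,
      hgv] at h2
    have h3 : ‖(CFC.sqrt g * (1 - P)) x‖ ^ 2 ≤ r ^ 2 / 4 * ‖x‖ ^ 2 := by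
      calc ‖(CFC.sqrt g * (1 - P)) x‖ ^ 2 ≤ (‖CFC.sqrt g * (1 - P)‖ * ‖x‖) ^ 2 := by
            gcongr; exact le_opNorm _ _
        _ ≤ r ^ 2 / 4 * ‖x‖ ^ 2 := by rw [mul_pow]; gcongr
    have h4 : r ^ 2 / 4 * ‖v‖ ^ 2 ≤ r ^ 2 / 4 * ‖x‖ ^ 2 := by gcongr
    rw [mul_apply_eq_comp, ← hvdef, hyv]
    linarith
  refine ⟨CFC.sqrt y * P, hPc.clm_comp (CFC.sqrt y), ?_⟩
  have h1 : CFC.sqrt y - CFC.sqrt y * P = CFC.sqrt y * (1 - P) := by rw [mul_sub, mul_one]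
  rw [dist_eq_norm, h1]
  nlinarith [norm_nonneg (CFC.sqrt y * (1 - P))]

/-- If `y e = t e` then `f(y) e = f(t) e`: the rank-one operator of `e` intertwines the scalar `t`
with `y`. -/
theorem cfc_apply_of_eigenvector {y : H →L[ℂ] H} (hy : 0 ≤ y) {e : H} {t : ℝ} (ht : 0 ≤ t)
    (he : y e = (t : ℂ) • e) {f : ℝ → ℝ} (hf : ContinuousOn f (Set.Ici 0)) :
    cfc f y e = (f t : ℂ) • e := by
  let a : H →L[ℂ] H := InnerProductSpace.rankOne ℂ e e
  have hx : (0 : H →L[ℂ] H) ≤ algebraMap ℝ (H →L[ℂ] H) t := by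
    rw [Algebra.algebraMap_eq_smul_one]
    exact smul_nonneg ht zero_le_one
  have h := CStarAlgebra.mul_cfc_eq_cfc_mul (a := a) hx hy (by
    ext v
    simp only [a, Algebra.algebraMap_eq_smul_one, mul_apply_eq_comp, smul_apply,
      InnerProductSpace.rankOne_apply, one_apply_eq_self, map_smul, he]
    rw [← Complex.coe_smul, inner_smul_right, smul_smul, mul_comm]) hf
  rw [cfc_algebraMap t f] at h
  have h1 := congrArg (fun T : H →L[ℂ] H => T e) h
  rcases eq_or_ne e 0 with rfl | he0
  · simp
  have h2 : ⟪e, e⟫_ℂ ≠ 0 := inner_self_ne_zero.mpr he0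
  simp only [a, mul_apply_eq_comp, InnerProductSpace.rankOne_apply, map_smul,
    Algebra.algebraMap_eq_smul_one, smul_apply, one_apply_eq_self] at h1
  refine smul_right_injective H h2 ?_
  simp only
  rw [← h1, ← Complex.coe_smul, inner_smul_right, smul_smul, mul_comm]

/-- The scalar bound `t ≤ η + η ^ (1 - q) t ^ q` for operators.  Being linear in `z ^ q`, it can be
summed over several `z`, and tested against any vector. -/
theorem le_algebraMap_add_rpow {z : H →L[ℂ] H} (hz : 0 ≤ z) {q η : ℝ} (hq : 1 ≤ q) (hη : 0 < η) :
    z ≤ algebraMap ℝ (H →L[ℂ] H) η + η ^ (1 - q) • z ^ q := by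
  have hc := CStarAlgebra.continuousOn_rpow (q := q) (by linarith)
  have hc' := hc.mono (CStarAlgebra.spectrum_subset_Ici_of_nonneg hz)
  rw [CFC.rpow_eq_cfc_real hz, ← cfc_smul (η ^ (1 - q)) (fun t : ℝ => t ^ q) z hc',
    ← cfc_const_add η (fun t : ℝ => η ^ (1 - q) • t ^ q) z
      (hc'.const_smul (η ^ (1 - q)))]
  nth_rw 1 [← cfc_id' ℝ z]
  refine CStarAlgebra.cfc_mono_of_nonneg hz continuousOn_id
    (continuousOn_const.add (hc.const_smul (η ^ (1 - q)))) fun t ht => ?_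
  rw [smul_eq_mul]
  rcases le_total t η with h | h
  · have : 0 ≤ η ^ (1 - q) * t ^ q := by positivity
    linarith
  · have ht' : 0 < t := hη.trans_le h
    have h1 : t ^ (1 - q) ≤ η ^ (1 - q) := Real.rpow_le_rpow_of_nonpos hη h (by linarith)
    have h2 : t ^ (1 - q) * t ^ q = t := by rw [← Real.rpow_add ht']; simp
    nlinarith [Real.rpow_nonneg ht q, mul_le_mul_of_nonneg_right h1 (Real.rpow_nonneg ht q)]

/-- If `0 ≤ y ≤ ∑ z j` and every `z j ^ q` has finite trace, then so has `y ^ q`, for every `q > 0`.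
When `q ≥ 1`, `y` is compact, and on its eigenvectors `y ^ q` is controlled by `∑ z j ^ q`. -/
theorem basisTrace_rpow_ne_top (b : HilbertBasis ι ℂ H) (c : HilbertBasis ι' ℂ H) {q : ℝ}
    (hq : 0 < q) (s : Finset κ) {z : κ → H →L[ℂ] H} (hz : ∀ j ∈ s, 0 ≤ z j) {y : H →L[ℂ] H}
    (hy : 0 ≤ y) (hyz : y ≤ ∑ j ∈ s, z j) (htr : ∀ j ∈ s, basisTrace b (z j ^ q) ≠ ⊤) :
    basisTrace c (y ^ q) ≠ ⊤ := by
  rw [basisTrace_eq_of_nonneg c b CFC.rpow_nonneg]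
  rcases le_total q 1 with hq1 | hq1
  · exact ne_top_of_le_ne_top (ENNReal.sum_ne_top.mpr htr)
      (basisTrace_rpow_le_sum b ⟨hq, hq1⟩ s hz hyz)
  set g := ∑ j ∈ s, z j ^ q with hgdef
  have hg : 0 ≤ g := Finset.sum_nonneg fun j _ => CFC.rpow_nonneg
  have hgtr : basisTrace b g ≠ ⊤ :=
    ne_top_of_le_ne_top (ENNReal.sum_ne_top.mpr htr) (basisTrace_sum_le b s _)
  -- The summand `1` keeps `N` positive when `s` is empty.
  set N : ℝ := s.card + 1 with hN
  have hN0 : 0 < N := by positivity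
  have hle : ∀ η : ℝ, 0 < η → y ≤ algebraMap ℝ (H →L[ℂ] H) (N * η) + η ^ (1 - q) • g := by
    intro η hη
    refine (hyz.trans (Finset.sum_le_sum fun j hj =>
      le_algebraMap_add_rpow (hz j hj) hq1 hη)).trans ?_
    rw [Finset.sum_add_distrib, ← Finset.smul_sum, ← map_sum]
    gcongr
    rw [Finset.sum_const, nsmul_eq_mul, hN]
    linarith
  have hcomp : IsCompactOperator y := by
    refine isCompactOperator_of_forall_le_add b hy fun ε hε => ?_
    have h := hle (ε / N) (by positivity)
    rw [mul_div_cancel₀ _ hN0.ne'] at h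
    refine ⟨_, smul_nonneg (by positivity) hg, ?_, h⟩
    rw [basisTrace_smul b (by positivity)]
    exact ENNReal.mul_ne_top ENNReal.ofReal_ne_top hgtr
  have hypos := (nonneg_iff_isPositive y).mp hy
  obtain ⟨ι'', e, μ, he⟩ := exists_hilbertBasis_eigenvectors hcomp hypos.isSymmetric
  rw [basisTrace_eq_of_nonneg b e CFC.rpow_nonneg]
  have hbound : basisTrace e (y ^ q) ≤ ENNReal.ofReal (2 * (2 * N) ^ (q - 1)) * basisTrace e g := by
    rw [basisTrace, basisTrace, ← ENNReal.tsum_mul_left]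
    refine ENNReal.tsum_le_tsum fun i => ?_
    rw [← ENNReal.ofReal_mul (by positivity)]
    refine ENNReal.ofReal_le_ofReal ?_
    have hei : ⟪e i, e i⟫_ℂ = 1 := by
      rw [inner_self_eq_norm_sq_to_K, e.orthonormal.norm_eq_one]; simp
    have hμ : ⟪e i, y (e i)⟫_ℂ = μ i := by rw [he, inner_smul_right, hei, mul_one]
    obtain ⟨t, ht, hμt⟩ : ∃ t : ℝ, 0 ≤ t ∧ (t : ℂ) = μ i := by
      have h := hypos.inner_nonneg_right (e i)
      rw [hμ, Complex.nonneg_iff] at h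
      exact ⟨(μ i).re, h.1, Complex.ext rfl h.2⟩
    have hgi : 0 ≤ RCLike.re ⟪e i, g (e i)⟫_ℂ :=
      ((nonneg_iff_isPositive g).mp hg).re_inner_nonneg_right _
    have h1 : RCLike.re ⟪e i, (y ^ q : H →L[ℂ] H) (e i)⟫_ℂ = t ^ q := by
      rw [CFC.rpow_eq_cfc_real hy, cfc_apply_of_eigenvector hy ht (by rw [he, hμt])
        (CStarAlgebra.continuousOn_rpow hq.le), inner_smul_right, hei, mul_one]
      simp
    rw [h1]
    rcases ht.eq_or_lt with rfl | ht
    · rw [Real.zero_rpow hq.ne']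
      positivity
    -- `η = t / (2 N)` makes the first term on the right of `hle` equal to `t / 2`.
    have h2 := re_inner_mono (hle (t / (2 * N)) (by positivity)) (e i)
    rw [hμ, ← hμt, add_apply, inner_add_right, map_add, Algebra.algebraMap_eq_smul_one, smul_apply,
      smul_apply, inner_smul_right_eq_smul, inner_smul_right_eq_smul, RCLike.smul_re,
      RCLike.smul_re, one_apply_eq_self, hei] at h2
    have h3 : N * (t / (2 * N)) = t / 2 := by field_simp
    have h4 : (t / (2 * N)) ^ (1 - q) = t ^ (1 - q) * (2 * N) ^ (q - 1) := by
      rw [Real.div_rpow ht.le (by positivity), div_eq_mul_inv, ← Real.rpow_neg (by positivity),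
        neg_sub]
    have h5 : t ^ q * t ^ (1 - q) = t := by rw [← Real.rpow_add ht]; simp
    rw [h3, h4] at h2
    simp only [RCLike.one_re, mul_one, RCLike.re_to_complex,
      Complex.ofReal_re] at h2 hgi ⊢
    have h6 : 0 < t ^ (1 - q) := Real.rpow_pos_of_pos ht _
    refine le_of_mul_le_mul_right ?_ h6
    rw [h5]
    linarith
  refine ne_top_of_le_ne_top (ENNReal.mul_ne_top ENNReal.ofReal_ne_top ?_) hbound
  rwa [← basisTrace_eq_of_nonneg b e hg]

end ContinuousLinearMap

/-! ### Resolvents and one-forms -/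

namespace SpectralTriple

variable {H : Type u} [NormedAddCommGroup H] [InnerProductSpace ℂ H]

/-- If the commutator `[D, T]` extends to the bounded operator `C`, then `T` can be moved past the
resolvent `R`: `T R = R (T + C R)`. -/
theorem IsCommutator.mul_resolvent {D : H →ₗ.[ℂ] H} {T C R : H →L[ℂ] H} {z : ℂ}
    (h : IsCommutator D T C) (hR : IsResolvent D z R) : T * R = R * (T + C * R) := by
  obtain ⟨hdom, hC⟩ := h
  ext y
  obtain ⟨hy, he⟩ := hR.1 y
  have h1 := hR.2 ⟨T (R y), hdom ⟨R y, hy⟩⟩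
  have h2 := hC ⟨R y, hy⟩
  simp only at h1 h2
  rw [sub_eq_iff_eq_add.mp he, eq_comm, sub_eq_iff_eq_add] at h2
  simp only [mul_apply_eq_comp, add_apply]
  rw [← h1, h2]
  congr 1
  simp only [map_add, map_smul]
  abel

variable [CompleteSpace H]

/-- The resolvent `(D - i)⁻¹` is normal. -/
theorem resolvent_mul_star_comm {D : H →ₗ.[ℂ] H} (hD : IsSelfAdjoint D) :
    resolvent D Complex.I * star (resolvent D Complex.I) =
      star (resolvent D Complex.I) * resolvent D Complex.I := by
  set R := resolvent D Complex.I
  have hR : IsResolvent D Complex.I R := isResolvent_resolvent hD (by simp)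
  have hS : IsResolvent D (-Complex.I) (star R) := isResolvent_star hD
  have h1 : ∀ y, star R y + (2 * Complex.I) • star R (R y) = R y := by
    intro y
    obtain ⟨h, e⟩ := hR.1 y
    have h2 := hS.2 ⟨R y, h⟩
    rw [sub_eq_iff_eq_add.mp e] at h2
    simp only at h2
    rw [← map_smul, ← map_add]
    refine Eq.trans (congrArg _ ?_) h2
    module
  have h3 : ∀ y, R y - (2 * Complex.I) • R (star R y) = star R y := by
    intro y
    obtain ⟨h, e⟩ := hS.1 y
    have h2 := hR.2 ⟨star R y, h⟩
    rw [sub_eq_iff_eq_add.mp e] at h2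
    simp only at h2
    rw [← map_smul, ← map_sub]
    refine Eq.trans (congrArg _ ?_) h2
    module
  ext y
  have h4 : (2 * Complex.I) • R (star R y) = (2 * Complex.I) • star R (R y) := by
    rw [eq_sub_of_add_eq' (h1 y)]
    nth_rw 2 [← h3 y]
    abel
  exact smul_right_injective H (by simp : (2 * Complex.I) ≠ 0) h4

/-- For `R' = (|D| - i)⁻¹` one has `R' R'⋆ = (1 + D²)⁻¹`: with `B = (1 + D²)^{-1/2}` and
`Q = |D| (1 + D²)^{-1/2}`, `R' = B (Q + i B)`, and `Q + i B` is unitary. -/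
theorem absOp_resolvent_mul_star {D : H →ₗ.[ℂ] H} (hD : IsSelfAdjoint D) :
    resolvent (absOp D) Complex.I * star (resolvent (absOp D) Complex.I) = invOneAddSq D := by
  obtain ⟨hB, hQ, hQB, hcomm⟩ := sqrt_facts hD
  have hR := isResolvent_resolvent (absOp_isSelfAdjoint hD) (z := Complex.I) (by simp)
  set B := CFC.sqrt (invOneAddSq D)
  set Q := CFC.sqrt (1 - invOneAddSq D)
  have hBs : star B = B := (CFC.sqrt_nonneg _).isSelfAdjoint
  have hQs : star Q = Q := (CFC.sqrt_nonneg _).isSelfAdjoint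
  have hBB : B * B = invOneAddSq D := CFC.sqrt_mul_sqrt_self _ (invOneAddSq_nonneg D)
  have hQQ : Q * Q = 1 - invOneAddSq D := CFC.sqrt_mul_sqrt_self _ (invOneAddSq_le_one hD)
  have h1 : resolvent (absOp D) Complex.I = B * (Q + Complex.I • B) := by
    ext y
    have hg := (mem_absOp_graph hD).mpr ⟨(Q + Complex.I • B) y, rfl, rfl⟩
    rw [LinearPMap.mem_graph_iff] at hg
    obtain ⟨x, hx, hw⟩ := hg
    simp only at hx hw
    have h2 := hR.2 x
    rw [hw, hx] at h2
    rw [mul_apply_eq_comp, ← h2]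
    congr 1
    simp only [add_apply, smul_apply, map_add, map_smul, smul_add, smul_smul, Complex.I_mul_I]
    change y = Q (Q y) + Complex.I • Q (B y) - (Complex.I • B (Q y) + (-1 : ℂ) • B (B y))
    rw [show Q (Q y) = y - invOneAddSq D y from hQ y, show B (B y) = invOneAddSq D y from hB y,
      show Q (B y) = B (Q y) from hQB y]
    module
  have h2 : (Q + Complex.I • B) * star (Q + Complex.I • B) = 1 := by
    rw [star_add, star_smul, hBs, hQs, add_mul, mul_add, mul_add, hQQ]
    simp only [smul_mul_assoc, mul_smul_comm, smul_smul, hBB, hcomm.eq]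
    simp
  rw [h1, star_mul, mul_assoc, ← mul_assoc _ _ (star B), h2, one_mul, hBs, hBB]

theorem mem_schattenClass_iff {p : ℝ} (hp : 0 ≤ p) (T : H →L[ℂ] H) :
    T ∈ schattenClass H p ↔ ∀ (ι : Type u) (b : HilbertBasis ι ℂ H),
      ContinuousLinearMap.basisTrace b ((star T * T) ^ (p / 2)) ≠ ⊤ := by
  have h1 : (CFC.abs T ^ p : H →L[ℂ] H) = (star T * T) ^ (p / 2) := by
    rw [CFC.abs, CFC.sqrt_eq_rpow, CFC.rpow_rpow_of_exponent_nonneg _ _ _ (by norm_num) hp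
      (star_mul_self_nonneg T)]
    congr 1
    ring
  rw [schattenClass, Set.mem_ofPred_eq, h1]
  refine forall_congr' fun ι => forall_congr' fun b => ?_
  have h2 : ∀ i, 0 ≤ RCLike.re ⟪b i, ((star T * T) ^ (p / 2) : H →L[ℂ] H) (b i)⟫_ℂ := fun i =>
    ((ContinuousLinearMap.nonneg_iff_isPositive _).mp CFC.rpow_nonneg).re_inner_nonneg_right _
  constructor
  · exact fun h => h.tsum_ofReal_ne_top
  · intro h
    refine (ENNReal.summable_toReal h).congr fun i => ENNReal.toReal_ofReal (h2 i)

end SpectralTriple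

open SpectralTriple ContinuousLinearMap in
theorem mainTheorem7 {H : Type u} [NormedAddCommGroup H] [InnerProductSpace ℂ H] [CompleteSpace H]
    [TopologicalSpace.SeparableSpace H] (t : LocallyCompactSpectralTriple H) (ht : t.IsRegular)
    (V : H →L[ℂ] H) (hV : V ∈ t.oneForms) :
    V * SpectralTriple.resolvent t.D Complex.I ∈ SpectralTriple.schattenClass H (t.s : ℝ) := by
  obtain ⟨n, a, b, C, habC, rfl⟩ := hV
  have hD := t.isSelfAdjoint_D
  have hs : (0 : ℝ) < t.s := by exact_mod_cast t.s_pos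
  set R := resolvent t.D Complex.I
  set R' := resolvent (absOp t.D) Complex.I
  have hR' : IsResolvent (absOp t.D) Complex.I R' :=
    isResolvent_resolvent (absOp_isSelfAdjoint hD) (by simp)
  set P := invOneAddSq t.D
  have hP : 0 ≤ P := invOneAddSq_nonneg t.D
  have hRR : R * star R = P := resolvent_mul_star_comm hD
  have hR'R' : R' * star R' = P := absOp_resolvent_mul_star hD
  choose C' hC' using fun j => (ht (b j) (habC j).2.1 (C j) (habC j).2.2 1 le_rfl).2
  set E := fun j => C j + C' j * R'
  -- Only `δ (C j)` is needed: it moves `C j` past the resolvent of `|D|`, leaving `a j` next to it.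
  have hVR' : (∑ j, a j * C j) * R' = ∑ j, a j * R' * E j := by
    rw [Finset.sum_mul]
    refine Finset.sum_congr rfl fun j _ => ?_
    rw [mul_assoc, (hC' j).1.mul_resolvent hR', mul_assoc]
  set V := ∑ j, a j * C j
  -- Contractions in the algebra, to which Hansen's inequality applies.
  set d := fun j => ((‖a j‖ + 1)⁻¹ : ℝ) • a j
  set w := fun j => d j * P ^ t.s * star (d j)
  have hw0 : ∀ j, 0 ≤ w j := fun j =>
    star_right_conjugate_nonneg (CStarAlgebra.pow_nonneg_of_nonneg hP _) _
  set c : Fin n → ℝ := fun j => n * (‖E j * star (E j)‖ * (‖a j‖ + 1) ^ 2) with hc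
  have hc0 : ∀ j, 0 ≤ c j := fun j => by positivity
  have hle : V * R * star (V * R) ≤ ∑ j, c j • w j ^ (1 / t.s : ℝ) := by
    -- `V R` and `V R'` have the same `T T⋆`, as `R R⋆ = R' R'⋆ = (1 + D²)⁻¹`.
    have h1 : V * R * star (V * R) = V * R' * star (V * R') := by
      rw [star_mul, star_mul, mul_assoc, mul_assoc V R', ← mul_assoc R, ← mul_assoc R', hRR, hR'R']
    rw [h1, hVR']
    refine (CStarAlgebra.sum_mul_star_sum_le _ _).trans ?_
    rw [Finset.smul_sum, Finset.card_univ, Fintype.card_fin]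
    refine Finset.sum_le_sum fun j _ => ?_
    rw [hc, mul_smul, mul_smul]
    refine smul_le_smul_of_nonneg_left ?_ (by positivity)
    calc a j * R' * E j * star (a j * R' * E j)
        = a j * R' * (E j * star (E j)) * star (a j * R') := by
          rw [star_mul]; simp only [mul_assoc]
      _ ≤ ‖E j * star (E j)‖ • (a j * R' * star (a j * R')) :=
          CStarAlgebra.star_right_conjugate_le_norm_smul
            (hb := (mul_star_self_nonneg (E j)).isSelfAdjoint)
      _ = ‖E j * star (E j)‖ • (a j * P * star (a j)) := by
          rw [star_mul, mul_assoc (a j) R', ← mul_assoc R', hR'R', ← mul_assoc]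
      _ ≤ _ := smul_le_smul_of_nonneg_left
          (CStarAlgebra.mul_mul_star_le_smul_rpow (a j) hP t.s_pos) (norm_nonneg _)
  rw [mem_schattenClass_iff (by positivity)]
  intro ι e
  have htr : ∀ j, basisTrace e ((c j • w j ^ (1 / t.s : ℝ)) ^ (t.s / 2 : ℝ)) ≠ ⊤ := by
    intro j
    rw [CStarAlgebra.smul_rpow (hc0 j) CFC.rpow_nonneg (by positivity),
      CFC.rpow_rpow_of_exponent_nonneg _ _ _ (by positivity) (by positivity) (hw0 j),
      basisTrace_smul e (by have := hc0 j; positivity)]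
    refine ENNReal.mul_ne_top ENNReal.ofReal_ne_top ?_
    have hdA : d j ∈ t.A := by
      have h := t.A.smul_mem (r := (((‖a j‖ + 1)⁻¹ : ℝ) : ℂ)) (habC j).1
      rwa [Complex.coe_smul] at h
    have h1 := (mem_schattenClass_iff zero_le_one _).mp (t.summable _ hdA) ι e
    -- `|(d R ^ s)⋆| = (w j) ^ (1 / 2)`, and `d R ^ s` is trace class as `d j` is in the algebra.
    have h2 : d j * R ^ t.s * star (d j * R ^ t.s) = w j := by
      have hcomm : Commute R (star R) := resolvent_mul_star_comm hD
      rw [star_mul, star_pow, mul_assoc, ← mul_assoc (R ^ t.s), ← hcomm.mul_pow, hRR, ← mul_assoc]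
    have h3 : (1 / t.s * (t.s / 2) : ℝ) = 1 / 2 := by field_simp
    rw [h3, ← h2]
    exact ne_top_of_le_ne_top h1 (basisTrace_rpow_mul_star_le e e _ (by norm_num))
  have hfin := basisTrace_rpow_ne_top e e (q := t.s / 2) (by positivity) Finset.univ
    (fun j _ => smul_nonneg (hc0 j) CFC.rpow_nonneg) (mul_star_self_nonneg (V * R)) hle
    (fun j _ => htr j)
  refine ne_top_of_le_ne_top hfin ?_
  have h := basisTrace_rpow_mul_star_le e e (star (V * R)) (q := t.s / 2) (by positivity)
  rwa [star_star] at h
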